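/- **Setting.** Two subnetworks $\Xi_1,\Xi_2$ have $n_1,n_2\ge 1$ agents. Let $X\subseteq\mathbb R^{m_1}$, $Y\subseteq\mathbb R^{m_2}$ be closed and convex. Agent $i$ of $\Xi_1$ has a function $f_i$ and agent $i$ of $\Xi_2$ a function $g_i$, all from $\mathbb R^{m_1}\times\mathbb R^{m_2}$ to $\mathbb R$, convex in the first and concave in the second argument, with $U=\sum_i f_i=\sum_i g_i$ on $X\times Y$. At each time $k=0,1,\dots$ there are nonnegative weights $a_{ij}(k)$ between agents; the arc $(j,i)$ is present at time $k$ iff $a_{ij}(k)>0$, and $a_{ii}(k)>0$ always. $A_\ell(k)$ is the matrix of the weights within $\Xi_\ell$, and $\mathcal N_i^\ell(k)$ is the set of the $j$ in $\Xi_\ell$ with $a_{ij}(k)>0$. Assume: * **A1.** For each stochastic vector $\mu$, $\sum_i\mu_if_i$ has a saddle point on $X\times Y$. * **A2.** For some $T>0$, in every time window of length $T$ each agent has at least once a neighbour in the other subnetwork; and for $\ell=1,2$ there is $T_\ell>0$ such that the union of the graphs of $A_\ell(s)$, $k\le s<k+T_\ell$, is strongly connected for every $k$. * **A3.** There is $\eta\in(0,1)$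 such that all positive weights are at least $\eta$; for each agent and time the weights of the neighbours in its own subnetwork sum to $1$; so do the weights of the neighbours in the other subnetwork whenever there is such a neighbour. * **A4.** There is $L>0$ with $|q|\le L$ for all $q\in\partial_xf_i(x,y)\cup\partial_yg_j(x,y)$, all $i,j$ and all $(x,y)\in X\times Y$. * $U$ is strictly convex-concave on $X\times Y$. * $\gamma_k$ is non-increasing, $\gamma_k\sum_{s<k}\gamma_s\to0$, $\sum_k\gamma_k=\infty$, $\sum_k\gamma_k^2<\infty$. **Algorithm.** With stepsizes $\alpha_{i,k},\beta_{i,k}>0$, from arbitrary initial states, $$x_i(k+1)=P_X\big(\hat x_i(k)-\alpha_{i,k}q_{1i}(k)\big),\quad q_{1i}(k)\in\partial_xf_i(\hat x_i(k),\breve x_i(k)),$$ $$y_i(k+1)=P_Y\big(\hat y_i(k)+\beta_{i,k}q_{2i}(k)\big),\quad q_{2i}(k)\in\partial_yg_i(\breve y_i(k),\hat y_i(k)),$$ where $\hat x_i(k)=\sum_{j\in\mathcal N^1_i(k)}a_{ij}(k)x_j(k)$, $\hat y_i(k)=\sum_{j\in\mathcal N^2_i(k)}a_{ij}(k)y_j(k)$,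 and $\breve x_i(k)=\sum_{j\in\mathcal N^2_i(\breve k_i)}a_{ij}(\breve k_i)y_j(\breve k_i)$, $\breve y_i(k)=\sum_{j\in\mathcal N^1_i(\breve k_i)}a_{ij}(\breve k_i)x_j(\breve k_i)$, with $\breve k_i\le k$ the last time up to $k$ at which agent $i$ had a neighbour in the other subnetwork ($\breve x_i(k)$, $\breve y_i(k)$ are arbitrary if there was none). The network *achieves a Nash equilibrium* if, for all initial states and all choices of subgradients, there is a saddle point $(x^*,y^*)$ of $U$ on $X\times Y$ with $x_i(k)\to x^*$ and $y_j(k)\to y^*$ for all agents $i$ of $\Xi_1$ and $j$ of $\Xi_2$. **Estimators.** The stepsizes are $\alpha_{i,k}=\gamma_k/\hat\alpha^i_k$, $\beta_{i,k}=\gamma_k/\hat\beta^i_k$. Call a rule that computes $\hat\alpha^i_k$ from the weights in $\Xi_1$ *distributed* if $\hat\alpha^i_k$ depends only on the information that agent $i$ has gathered up to time $k$, where at each time $s$ an agent learns the weights $a_{ij}(s)$, $j\in\mathcal N^1_i(s)$, and receives from these neighbours what they had gathered before time $s$. Say that positive estimates *learn the Perron entries* if, for each $s$, $\lim_{r\to\infty}A_1(r)\cdots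 A_1(s)=\mathbf 1\phi^1(s)'$ for some vector $\phi^1(s)$, and $\hat\alpha^i_k-\phi^1_i(k+1)\to0$ as $k\to\infty$ for each $i$. The same is defined for $\hat\beta^i_k$ with $\Xi_2$, $A_2$, $\phi^2$. For a start time $t$ let $\alpha^{[t]i}(t)$ be the $i$-th unit vector and $\alpha^{[t]i}(s+1)=\sum_{j\in\mathcal N^1_i(s)}a_{ij}(s)\alpha^{[t]j}(s)$ for $s\ge t$ (for $s<t$, $\alpha^{[t]i}(s)$ is the $i$-th unit vector by convention); $\beta^{[t]i}$ is defined alike in $\Xi_2$. **Theorem.** (i) Suppose that, for $\ell=1,2$, the matrices $A_\ell(k)$, $k\ge0$, have a common left eigenvector with eigenvalue one. Then the estimates $\hat\alpha^i_k=\alpha^{[0]i}_i(k)$, $\hat\beta^i_k=\beta^{[0]i}_i(k)$ are distributed, positive and learn the Perron entries, and with them the network achieves a Nash equilibrium. (ii) Suppose that, for $\ell=1,2$, there are $p^\ell\geq 1$ and stochastic matrices $A^0_\ell,\dots,A_\ell^{p^\ell-1}$ with $A_\ell(rp^\ell+s)=A_\ell^s$ for all $r\ge0$, $0\le s<p^\ell$.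 Then the estimates $\hat\alpha^i_{rp^1+\nu}=\alpha^{[\nu+1]i}_i(rp^1+\nu)$, $0\le\nu<p^1$, and $\hat\beta^i_{rp^2+\nu}=\beta^{[\nu+1]i}_i(rp^2+\nu)$, $0\le\nu<p^2$, are distributed (given $p^1,p^2$), positive and learn the Perron entries, and with them the network achieves a Nash equilibrium. Moreover, in each of these two cases the network achieves a Nash equilibrium with any distributed positive estimates that learn the Perron entries. -/

import Mathlib

open Filter Topology

noncomputable section

/-- `ℝ^m` with the Euclidean norm. -/
abbrev Euc (m : ℕ) : Type := EuclideanSpace ℝ (Fin m)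

/-! ### Convex analysis -/

/-- `φ(x, y)` is convex in `x` and concave in `y`, on the whole space. -/
def ConvexConcave {m₁ m₂ : ℕ} (φ : Euc m₁ → Euc m₂ → ℝ) : Prop :=
  (∀ y, ConvexOn ℝ Set.univ (fun x => φ x y)) ∧ (∀ x, ConcaveOn ℝ Set.univ (fun y => φ x y))

/-- `φ(x, y)` is strictly convex in `x ∈ X` for each `y ∈ Y` and strictly concave in `y ∈ Y` for
each `x ∈ X`. -/
def StrictConvexConcaveOn {m₁ m₂ : ℕ} (X : Set (Euc m₁)) (Y : Set (Euc m₂))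
    (φ : Euc m₁ → Euc m₂ → ℝ) : Prop :=
  (∀ y ∈ Y, StrictConvexOn ℝ X (fun x => φ x y)) ∧
    (∀ x ∈ X, StrictConcaveOn ℝ Y (fun y => φ x y))

/-- The subdifferential of a convex function. -/
def convexSubdiff {m : ℕ} (φ : Euc m → ℝ) (z : Euc m) : Set (Euc m) :=
  {v | ∀ w, φ z + inner ℝ (w - z) v ≤ φ w}

/-- The subdifferential of a concave function. -/
def concaveSubdiff {m : ℕ} (φ : Euc m → ℝ) (z : Euc m) : Set (Euc m) :=
  {v | ∀ w, φ w ≤ φ z + inner ℝ (w - z) v}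

/-- `p` is the projection of `z` onto `K`, the nearest point of `K`. -/
def IsProjection {m : ℕ} (K : Set (Euc m)) (z p : Euc m) : Prop :=
  p ∈ K ∧ ∀ w ∈ K, ‖z - p‖ ≤ ‖z - w‖

/-- `(xs, ys)` is a saddle point of `φ` on `X × Y`. -/
def IsSaddlePoint {m₁ m₂ : ℕ} (X : Set (Euc m₁)) (Y : Set (Euc m₂)) (φ : Euc m₁ → Euc m₂ → ℝ)
    (xs : Euc m₁) (ys : Euc m₂) : Prop :=
  xs ∈ X ∧ ys ∈ Y ∧ (∀ y ∈ Y, φ xs y ≤ φ xs ys) ∧ (∀ x ∈ X, φ xs ys ≤ φ x ys)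

/-- The sum objective function of a subnetwork. -/
def sumObjective {n m₁ m₂ : ℕ} (f : Fin n → Euc m₁ → Euc m₂ → ℝ) (x : Euc m₁) (y : Euc m₂) : ℝ :=
  ∑ i, f i x y

/-! ### The time-varying network -/

/-- The neighbours of node `i` when the weights are `M`: those `j` for which the weight `M i j` of
the arc `(j, i)` is positive. -/
def neighbors {n m : ℕ} (M : Matrix (Fin n) (Fin m) ℝ) (i : Fin n) : Finset (Fin m) :=
  Finset.univ.filter (fun j => 0 < M i j)

/-- The communication structure of two subnetworks of `n₁` and `n₂` agents. `A₁ k`, `A₂ k` are the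
weighted adjacency matrices of the subnetworks at time `k`; `B₁ k i j` is the weight of the arc from
agent `j` of the second subnetwork to agent `i` of the first, and `B₂ k i j` that of the arc from
agent `j` of the first subnetwork to agent `i` of the second. An arc is present exactly when its
weight is positive, and every node has a self-loop. -/
structure Network (n₁ n₂ : ℕ) where
  A₁ : ℕ → Matrix (Fin n₁) (Fin n₁) ℝ
  A₂ : ℕ → Matrix (Fin n₂) (Fin n₂) ℝ
  B₁ : ℕ → Matrix (Fin n₁) (Fin n₂) ℝ
  B₂ : ℕ → Matrix (Fin n₂) (Fin n₁) ℝ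
  A₁_nonneg : ∀ k i j, 0 ≤ A₁ k i j
  A₂_nonneg : ∀ k i j, 0 ≤ A₂ k i j
  B₁_nonneg : ∀ k i j, 0 ≤ B₁ k i j
  B₂_nonneg : ∀ k i j, 0 ≤ B₂ k i j
  A₁_loop : ∀ k i, 0 < A₁ k i i
  A₂_loop : ∀ k i, 0 < A₂ k i i

/-- There is an arc `(j, i)` in the union of the graphs of `A s`, `k ≤ s < k + T`. -/
def unionArc {n : ℕ} (A : ℕ → Matrix (Fin n) (Fin n) ℝ) (k T : ℕ) (j i : Fin n) : Prop :=
  ∃ s, k ≤ s ∧ s < k + T ∧ j ∈ neighbors (A s) i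

/-- Uniformly jointly strongly connected. -/
def UJSC {n : ℕ} (A : ℕ → Matrix (Fin n) (Fin n) ℝ) : Prop :=
  ∃ T : ℕ, 0 < T ∧ ∀ k i j, Relation.ReflTransGen (unionArc A k T) i j

/-- Connectivity: the interconnection graph is uniformly jointly bipartite without isolated nodes,
and both subnetworks are uniformly jointly strongly connected. -/
def Connectivity {n₁ n₂ : ℕ} (N : Network n₁ n₂) : Prop :=
  (∃ T : ℕ, 0 < T ∧ ∀ k,
    (∀ i, ∃ s, k ≤ s ∧ s < k + T ∧ (neighbors (N.B₁ s) i).Nonempty) ∧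
    (∀ i, ∃ s, k ≤ s ∧ s < k + T ∧ (neighbors (N.B₂ s) i).Nonempty)) ∧
  UJSC N.A₁ ∧ UJSC N.A₂

/-- The weights of all arcs are at least `η`. -/
def WeightsAtLeast {n m : ℕ} (η : ℝ) (M : ℕ → Matrix (Fin n) (Fin m) ℝ) : Prop :=
  ∀ k i, ∀ j ∈ neighbors (M k) i, η ≤ M k i j

/-- Weight rule: the weights of arcs are bounded below by some `η ∈ (0, 1)`, the weights that an
agent gives to its neighbours in its own subnetwork sum to one, and so do those that it gives to its
neighbours in the other subnetwork at every time when it has one. -/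
def WeightRule {n₁ n₂ : ℕ} (N : Network n₁ n₂) : Prop :=
  (∃ η : ℝ, 0 < η ∧ η < 1 ∧ WeightsAtLeast η N.A₁ ∧ WeightsAtLeast η N.A₂ ∧
    WeightsAtLeast η N.B₁ ∧ WeightsAtLeast η N.B₂) ∧
  (∀ k i, ∑ j ∈ neighbors (N.A₁ k) i, N.A₁ k i j = 1) ∧
  (∀ k i, ∑ j ∈ neighbors (N.A₂ k) i, N.A₂ k i j = 1) ∧
  (∀ s i, (neighbors (N.B₁ s) i).Nonempty → ∑ j ∈ neighbors (N.B₁ s) i, N.B₁ s i j = 1) ∧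
  (∀ s i, (neighbors (N.B₂ s) i).Nonempty → ∑ j ∈ neighbors (N.B₂ s) i, N.B₂ s i j = 1)

/-- Existence of saddle points of all the weighted objectives `∑ μ_i f_i`, `μ` stochastic. -/
def SaddlePointsExist {n m₁ m₂ : ℕ} (X : Set (Euc m₁)) (Y : Set (Euc m₂))
    (f : Fin n → Euc m₁ → Euc m₂ → ℝ) : Prop :=
  ∀ μ ∈ stdSimplex ℝ (Fin n), ∃ xs ys, IsSaddlePoint X Y (fun x y => ∑ i, μ i * f i x y) xs ys

/-- Boundedness of subgradients. -/
def SubgradientsBounded {n₁ n₂ m₁ m₂ : ℕ} (X : Set (Euc m₁)) (Y : Set (Euc m₂))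
    (f : Fin n₁ → Euc m₁ → Euc m₂ → ℝ) (g : Fin n₂ → Euc m₁ → Euc m₂ → ℝ) : Prop :=
  ∃ L : ℝ, 0 < L ∧ ∀ x ∈ X, ∀ y ∈ Y,
    (∀ i, ∀ q ∈ convexSubdiff (fun x' => f i x' y) x, ‖q‖ ≤ L) ∧
    (∀ j, ∀ q ∈ concaveSubdiff (fun y' => g j x y') y, ‖q‖ ≤ L)

/-! ### The algorithm -/

/-- The weighted average, with weights `M i j`, of the states `z j` of the neighbours of `i`. -/
def neighborAverage {n m d : ℕ} (M : Matrix (Fin n) (Fin m) ℝ) (z : Fin m → Euc d) (i : Fin n) :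
    Euc d :=
  ∑ j ∈ neighbors M i, M i j • z j

/-- `s` is the last time up to `k` at which agent `i` has a neighbour in the other subnetwork. -/
def IsLastContact {n m : ℕ} (B : ℕ → Matrix (Fin n) (Fin m) ℝ) (i : Fin n) (k s : ℕ) : Prop :=
  IsGreatest {t | t ≤ k ∧ (neighbors (B t) i).Nonempty} s

/-- `x k i`, `y k i` are states produced by the distributed Nash equilibrium computation algorithm
with stepsizes `α k i`, `β k i`, from arbitrary initial states and with arbitrary choices of the
subgradients `q₁`, `q₂`. `xb`, `yb` are the averages of the latest states received from the other
subnetwork; they are arbitrary as long as an agent has not yet had any contact with it. -/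
def IsRun {n₁ n₂ m₁ m₂ : ℕ} (X : Set (Euc m₁)) (Y : Set (Euc m₂))
    (f : Fin n₁ → Euc m₁ → Euc m₂ → ℝ) (g : Fin n₂ → Euc m₁ → Euc m₂ → ℝ) (N : Network n₁ n₂)
    (α : ℕ → Fin n₁ → ℝ) (β : ℕ → Fin n₂ → ℝ)
    (x : ℕ → Fin n₁ → Euc m₁) (y : ℕ → Fin n₂ → Euc m₂) : Prop :=
  ∃ (xb : ℕ → Fin n₁ → Euc m₂) (yb : ℕ → Fin n₂ → Euc m₁)
    (q₁ : ℕ → Fin n₁ → Euc m₁) (q₂ : ℕ → Fin n₂ → Euc m₂),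
    (∀ k i s, IsLastContact N.B₁ i k s → xb k i = neighborAverage (N.B₁ s) (y s) i) ∧
    (∀ k i s, IsLastContact N.B₂ i k s → yb k i = neighborAverage (N.B₂ s) (x s) i) ∧
    (∀ k i, q₁ k i ∈
      convexSubdiff (fun x' => f i x' (xb k i)) (neighborAverage (N.A₁ k) (x k) i)) ∧
    (∀ k i, q₂ k i ∈
      concaveSubdiff (fun y' => g i (yb k i) y') (neighborAverage (N.A₂ k) (y k) i)) ∧
    (∀ k i, IsProjection X (neighborAverage (N.A₁ k) (x k) i - α k i • q₁ k i) (x (k + 1) i)) ∧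
    (∀ k i, IsProjection Y (neighborAverage (N.A₂ k) (y k) i + β k i • q₂ k i) (y (k + 1) i))

/-- The network achieves a Nash equilibrium (a saddle point of the sum objective function). -/
def AchievesNash {n₁ n₂ m₁ m₂ : ℕ} (X : Set (Euc m₁)) (Y : Set (Euc m₂))
    (f : Fin n₁ → Euc m₁ → Euc m₂ → ℝ) (g : Fin n₂ → Euc m₁ → Euc m₂ → ℝ) (N : Network n₁ n₂)
    (α : ℕ → Fin n₁ → ℝ) (β : ℕ → Fin n₂ → ℝ) : Prop :=
  ∀ x y, IsRun X Y f g N α β x y →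
    ∃ xs ys, IsSaddlePoint X Y (sumObjective f) xs ys ∧
      (∀ i, Tendsto (fun k => x k i) atTop (𝓝 xs)) ∧
      (∀ i, Tendsto (fun k => y k i) atTop (𝓝 ys))

/-- The conditions on the basic stepsizes `γ_k`. -/
def StepsizeCondition (γ : ℕ → ℝ) : Prop :=
  Tendsto (fun k => γ k * ∑ s ∈ Finset.range k, γ s) atTop (𝓝 0) ∧
    Antitone γ ∧
    Tendsto (fun k => ∑ s ∈ Finset.range k, γ s) atTop atTop ∧
    Summable (fun k => γ k ^ 2)

/-! ### Perron vectors and distributed estimators -/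

/-- The transition matrix `Φ(k, s) = A(k) A(k-1) ⋯ A(s)` for `k ≥ s` (and `1` for `k < s`). -/
def transition {n : ℕ} (A : ℕ → Matrix (Fin n) (Fin n) ℝ) (s : ℕ) : ℕ → Matrix (Fin n) (Fin n) ℝ
  | 0 => if s = 0 then A 0 else 1
  | k + 1 => if s ≤ k + 1 then A (k + 1) * transition A s k else 1

/-- `Φ(r, s)` tends to `𝟏 φ'` as `r → ∞`. -/
def IsPerronLimit {n : ℕ} (A : ℕ → Matrix (Fin n) (Fin n) ℝ) (s : ℕ) (φ : Fin n → ℝ) : Prop :=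
  ∀ i j, Tendsto (fun r => transition A s r i j) atTop (𝓝 (φ j))

/-- An estimation rule: from the sequence of adjacency matrices of a subnetwork it computes the
estimate of agent `i` at time `k`. -/
abbrev Estimator (n : ℕ) : Type := (ℕ → Matrix (Fin n) (Fin n) ℝ) → ℕ → Fin n → ℝ

/-- The information that agent `i` has gathered before time `k` is the same for the weight
sequences `A` and `A'`. At each time an agent learns the weights of its incoming arcs and receives
from its neighbours all that they have gathered before. -/
def SameInfo {n : ℕ} (A A' : ℕ → Matrix (Fin n) (Fin n) ℝ) : ℕ → Fin n → Prop
  | 0, _ => True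
  | k + 1, i => SameInfo A A' k i ∧
      (∀ j ∈ neighbors (A k) i ∪ neighbors (A' k) i, A k i j = A' k i j) ∧
      (∀ j ∈ neighbors (A k) i, SameInfo A A' k j)

/-- The estimate of agent `i` at time `k` depends only on what agent `i` has learned from its own
weights and from its neighbours at the times `s ≤ k`. -/
def IsDistributed {n : ℕ} (est : Estimator n) : Prop :=
  ∀ A A' k i, SameInfo A A' (k + 1) i → est A k i = est A' k i

/-- The estimates are positive, and their difference from the `i`-th entry of the vector `φ(k+1)`,
where `lim_r Φ(r, k+1) = 𝟏 φ(k+1)'`, tends to zero. -/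
def LearnsPerron {n : ℕ} (A : ℕ → Matrix (Fin n) (Fin n) ℝ) (est : Estimator n) : Prop :=
  (∀ k i, 0 < est A k i) ∧
    ∃ φ : ℕ → Fin n → ℝ, (∀ s, IsPerronLimit A s (φ s)) ∧
      ∀ i, Tendsto (fun k => est A k i - φ (k + 1) i) atTop (𝓝 0)

/-- The consensus dynamics for auxiliary vectors started at time `t`: `auxState A t s i` is the
vector held by agent `i` at time `s`. At time `t` (and, by convention, before) it is the `i`-th unit
vector; at later times it is the weighted average of the vectors of the neighbours. -/
def auxState {n : ℕ} (A : ℕ → Matrix (Fin n) (Fin n) ℝ) (t : ℕ) : ℕ → Fin n → Fin n → ℝ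
  | 0 => fun i j => if j = i then 1 else 0
  | s + 1 => fun i j =>
      if s + 1 ≤ t then (if j = i then 1 else 0)
      else ∑ l ∈ neighbors (A s) i, A s i l * auxState A t s l j

/-- The estimate is the own entry of the auxiliary vector started at time `0`. -/
def consensusEstimator (n : ℕ) : Estimator n := fun A k i => auxState A 0 k i i

/-- For period `p` there are `p` auxiliary dynamics, the `ν`-th started at time `ν + 1`; at the
times `k = r p + ν` the estimate is the own entry of the `ν`-th auxiliary vector. -/
def periodicEstimator (n p : ℕ) : Estimator n := fun A k i => auxState A (k % p + 1) k i i

/-- The stepsizes `γ_k` divided by the estimates. -/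
def learnedStepsize {n : ℕ} (A : ℕ → Matrix (Fin n) (Fin n) ℝ) (est : Estimator n) (γ : ℕ → ℝ) :
    ℕ → Fin n → ℝ :=
  fun k i => 1 / est A k i * γ k

/-! ### The two cases -/

/-- The matrices `A k` have a common left eigenvector for the eigenvalue one. -/
def HasCommonLeftEigenvector {n : ℕ} (A : ℕ → Matrix (Fin n) (Fin n) ℝ) : Prop :=
  ∃ v : Fin n → ℝ, v ≠ 0 ∧ ∀ k, Matrix.vecMul v (A k) = v

/-- The matrices `A k` switch periodically, with period `p`, among stochastic matrices `S s`. -/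
def SwitchesPeriodically {n : ℕ} (A : ℕ → Matrix (Fin n) (Fin n) ℝ) (p : ℕ) : Prop :=
  0 < p ∧ ∃ S : Fin p → Matrix (Fin n) (Fin n) ℝ,
    (∀ s, S s ∈ Matrix.rowStochastic ℝ (Fin n)) ∧ ∀ (r : ℕ) (s : Fin p), A (r * p + s) = S s

end

/-!
The Lyapunov function is `∑ i, φ¹ᵢ(k) ‖xᵢ(k) - x*‖² + ∑ j, φ²ⱼ(k) ‖yⱼ(k) - y*‖²`, where `(x*, y*)`
is the saddle point and `φ¹(k)`, `φ²(k)` are the Perron vectors. Since `φ(k)' = φ(k+1)' A(k)`, the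
averaging step does not increase it, and because each stepsize is divided by (an estimate of) the
Perron entry of its agent, the subgradient steps of the agents add up to a step along `U`. The
consensus errors and the delays vanish in the limit and perturb the descent by `o(1)` times the
distance to the saddle point, while strict convexity-concavity makes the descent itself grow at
least linearly in that distance. As `∑ γ k = ∞`, the Lyapunov function tends to zero.

The Perron vector is constant in case (i) and periodic in case (ii). It is therefore the limit of
the auxiliary consensus dynamics started at time `0`, respectively at time `ν + 1` for each residue
`ν` modulo the period.
-/

noncomputable section

/-! ### Products of nonnegative and stochastic matrices -/

theorem sum_neighbors_smul {n m : ℕ} {M : Matrix (Fin n) (Fin m) ℝ} (hM : ∀ i j, 0 ≤ M i j)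
    {E : Type*} [AddCommGroup E] [Module ℝ E] (z : Fin m → E) (i : Fin n) :
    ∑ j ∈ neighbors M i, M i j • z j = ∑ j, M i j • z j := by
  refine Finset.sum_subset (Finset.subset_univ _) fun j _ hj => ?_
  have hMij : M i j = 0 := le_antisymm (by simpa [neighbors] using hj) (hM i j)
  rw [hMij, zero_smul]

section StepProd

variable {ι : Type*} [Fintype ι] [DecidableEq ι] {A : ℕ → Matrix ι ι ℝ}

/-- The backward product `A (s + w - 1) ⋯ A (s + 1) A s` of `w` consecutive factors. In contrast to
`transition` it is indexed by the number of factors, so that the empty product has its own index. -/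
def stepProd (A : ℕ → Matrix ι ι ℝ) (s : ℕ) : ℕ → Matrix ι ι ℝ
  | 0 => 1
  | w + 1 => A (s + w) * stepProd A s w

theorem stepProd_add (A : ℕ → Matrix ι ι ℝ) (s v w : ℕ) :
    stepProd A s (v + w) = stepProd A (s + v) w * stepProd A s v := by
  induction w with
  | zero => simp [stepProd]
  | succ w ih => rw [← add_assoc, stepProd, ih, stepProd, Matrix.mul_assoc, add_assoc]

theorem stepProd_succ' (A : ℕ → Matrix ι ι ℝ) (s w : ℕ) :
    stepProd A s (w + 1) = stepProd A (s + 1) w * A s := by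
  rw [add_comm w 1, stepProd_add]
  simp [stepProd]

theorem vecMul_stepProd {v : ι → ℝ} (hv : ∀ k, Matrix.vecMul v (A k) = v) (s w : ℕ) :
    Matrix.vecMul v (stepProd A s w) = v := by
  induction w with
  | zero => simp [stepProd]
  | succ w ih => rw [stepProd, ← Matrix.vecMul_vecMul, hv, ih]

theorem stepProd_add_period {p : ℕ} (hA : Function.Periodic A p) (s w : ℕ) :
    stepProd A (s + p) w = stepProd A s w := by
  induction w with
  | zero => rfl
  | succ w ih => rw [stepProd, stepProd, ih, add_right_comm, hA]

theorem stepProd_nonneg (hA : ∀ k i j, 0 ≤ A k i j) (s w : ℕ) (i j : ι) :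
    0 ≤ stepProd A s w i j := by
  induction w generalizing i with
  | zero => simp only [stepProd, Matrix.one_apply]; split_ifs <;> norm_num
  | succ w ih =>
    rw [stepProd, Matrix.mul_apply]
    exact Finset.sum_nonneg fun l _ => mul_nonneg (hA _ _ _) (ih l)

theorem stepProd_mem_rowStochastic (hA : ∀ k, A k ∈ Matrix.rowStochastic ℝ ι) (s w : ℕ) :
    stepProd A s w ∈ Matrix.rowStochastic ℝ ι := by
  induction w with
  | zero => exact one_mem _
  | succ w ih => exact mul_mem (hA _) ih

theorem mul_le_stepProd_succ (hA : ∀ k i j, 0 ≤ A k i j) (s w : ℕ) (i l j : ι) :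
    A (s + w) i l * stepProd A s w l j ≤ stepProd A s (w + 1) i j := by
  rw [stepProd, Matrix.mul_apply]
  exact Finset.single_le_sum (f := fun l => A (s + w) i l * stepProd A s w l j)
    (fun l _ => mul_nonneg (hA _ _ _) (stepProd_nonneg hA _ _ _ _)) (Finset.mem_univ l)

theorem exists_pos_of_stepProd_succ_pos (hA : ∀ k i j, 0 ≤ A k i j) {s w : ℕ} {i j : ι}
    (hpos : 0 < stepProd A s (w + 1) i j) : ∃ l, 0 < A (s + w) i l ∧ 0 < stepProd A s w l j := by
  rw [stepProd, Matrix.mul_apply] at hpos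
  obtain ⟨l, -, hl⟩ := Finset.exists_lt_of_sum_lt (f := fun _ => (0 : ℝ)) (by simpa using hpos)
  exact ⟨l, pos_of_mul_pos_left hl (stepProd_nonneg hA _ _ _ _),
    pos_of_mul_pos_right hl (hA _ _ _)⟩

theorem stepProd_pos_mono (hA : ∀ k i j, 0 ≤ A k i j) (hloop : ∀ k i, 0 < A k i i) {s v w : ℕ}
    (hvw : v ≤ w) {i j : ι} (hpos : 0 < stepProd A s v i j) : 0 < stepProd A s w i j := by
  induction w, hvw using Nat.le_induction with
  | base => exact hpos
  | succ w _ ih => exact (mul_pos (hloop _ _) ih).trans_le (mul_le_stepProd_succ hA s w i i j)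

theorem stepProd_diag_pos (hA : ∀ k i j, 0 ≤ A k i j) (hloop : ∀ k i, 0 < A k i i) (s w : ℕ)
    (i : ι) : 0 < stepProd A s w i i :=
  stepProd_pos_mono hA hloop (Nat.zero_le w) (by simp [stepProd])

theorem pow_le_stepProd {η : ℝ} (hη : 0 ≤ η) (hA : ∀ k i j, 0 ≤ A k i j)
    (hlower : ∀ k i j, 0 < A k i j → η ≤ A k i j) {s w : ℕ} {i j : ι}
    (hpos : 0 < stepProd A s w i j) : η ^ w ≤ stepProd A s w i j := by
  induction w generalizing i with
  | zero =>
    simp only [stepProd, Matrix.one_apply, pow_zero] at hpos ⊢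
    split_ifs at hpos ⊢ <;> simp_all
  | succ w ih =>
    obtain ⟨l, hAl, hl⟩ := exists_pos_of_stepProd_succ_pos hA hpos
    calc η ^ (w + 1) = η * η ^ w := pow_succ' _ _
      _ ≤ A (s + w) i l * stepProd A s w l j := by
        gcongr
        exacts [hlower _ _ _ hAl, ih hl]
      _ ≤ stepProd A s (w + 1) i j := mul_le_stepProd_succ hA s w i l j

end StepProd

/-! ### Joint strong connectivity -/

theorem exists_rel_leaving {α : Type*} {r : α → α → Prop} {S : Set α} {a b : α}
    (h : Relation.ReflTransGen r a b) (ha : a ∈ S) (hb : b ∉ S) :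
    ∃ c d, r c d ∧ c ∈ S ∧ d ∉ S := by
  induction h with
  | refl => exact absurd ha hb
  | @tail c d _ hcd ih =>
    by_cases hc : c ∈ S
    · exact ⟨c, d, hcd, hc, hb⟩
    · exact ih hc

section Connectivity

variable {n : ℕ} {A : ℕ → Matrix (Fin n) (Fin n) ℝ}

/-- The agents whose states at time `s + w` put positive weight, under the averaging dynamics, on
the state of agent `j` at time `s`. -/
def reached (A : ℕ → Matrix (Fin n) (Fin n) ℝ) (s w : ℕ) (j : Fin n) : Finset (Fin n) :=
  Finset.univ.filter fun i => 0 < stepProd A s w i j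

theorem mem_reached {s w : ℕ} {i j : Fin n} : i ∈ reached A s w j ↔ 0 < stepProd A s w i j := by
  simp [reached]

theorem reached_mono (hA : ∀ k i j, 0 ≤ A k i j) (hloop : ∀ k i, 0 < A k i i) {s v w : ℕ}
    (hvw : v ≤ w) (j : Fin n) : reached A s v j ⊆ reached A s w j := fun _ hi =>
  mem_reached.2 (stepProd_pos_mono hA hloop hvw (mem_reached.1 hi))

theorem reached_ssubset (hA : ∀ k i j, 0 ≤ A k i j) (hloop : ∀ k i, 0 < A k i i) {s w T : ℕ}
    (hT : ∀ i j, Relation.ReflTransGen (unionArc A (s + w) T) i j) {j : Fin n}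
    (hne : reached A s w j ≠ Finset.univ) : reached A s w j ⊂ reached A s (w + T) j := by
  obtain ⟨b, hb⟩ : ∃ b, b ∉ reached A s w j := by
    simpa [Finset.eq_univ_iff_forall] using hne
  have hj : j ∈ reached A s w j := mem_reached.2 (stepProd_diag_pos hA hloop s w j)
  obtain ⟨c, d, ⟨t, hwt, htT, hcd⟩, hc, hd⟩ :=
    exists_rel_leaving (S := (reached A s w j : Set (Fin n))) (hT j b) hj hb
  obtain ⟨u, rfl⟩ : ∃ u, t = s + u := ⟨t - s, by omega⟩
  have hcu : 0 < stepProd A s u c j :=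
    mem_reached.1 (reached_mono hA hloop (by omega) j hc)
  have hdu : d ∈ reached A s (u + 1) j := mem_reached.2 <|
    (mul_pos (by simpa [neighbors] using hcd) hcu).trans_le (mul_le_stepProd_succ hA s u d c j)
  exact Finset.ssubset_iff_subset_ne.2 ⟨reached_mono hA hloop (Nat.le_add_right _ _) j,
    fun heq => hd (heq ▸ reached_mono hA hloop (by omega) j hdu)⟩

theorem min_le_card_reached (hA : ∀ k i j, 0 ≤ A k i j) (hloop : ∀ k i, 0 < A k i i) {T : ℕ}
    (hT : ∀ k i j, Relation.ReflTransGen (unionArc A k T) i j) (s m : ℕ) (j : Fin n) :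
    min n m ≤ (reached A s (m * T) j).card := by
  induction m with
  | zero => simp
  | succ m ih =>
    by_cases hfull : reached A s (m * T) j = Finset.univ
    · have hsub : reached A s (m * T) j ⊆ reached A s ((m + 1) * T) j :=
        reached_mono hA hloop (Nat.mul_le_mul_right T (Nat.le_succ m)) j
      have hcard := Finset.card_le_card hsub
      rw [hfull, Finset.card_univ, Fintype.card_fin] at hcard
      exact (min_le_left _ _).trans hcard
    · have hlt := Finset.card_lt_card (reached_ssubset hA hloop (hT (s + m * T)) hfull)
      rw [Nat.succ_mul]
      omega

theorem exists_forall_stepProd_pos (hA : ∀ k i j, 0 ≤ A k i j) (hloop : ∀ k i, 0 < A k i i)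
    (hconn : UJSC A) : ∃ W > 0, ∀ s i j, 0 < stepProd A s W i j := by
  obtain ⟨T, hT_pos, hT⟩ := hconn
  refine ⟨(n + 1) * T, by positivity, fun s i j => mem_reached.1 ?_⟩
  have hcard : Fintype.card (Fin n) ≤ (reached A s ((n + 1) * T) j).card := by
    simpa using min_le_card_reached hA hloop hT s (n + 1) j
  have huniv : reached A s ((n + 1) * T) j = Finset.univ :=
    (Finset.card_eq_iff_eq_univ _).1 (le_antisymm (Finset.card_le_univ _) hcard)
  exact huniv ▸ Finset.mem_univ i

/-- The weights of a subnetwork as the consensus theory needs them: row stochastic, with self-loops,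
bounded away from zero on the arcs, and uniformly jointly strongly connected. -/
structure ConsensusWeights (A : ℕ → Matrix (Fin n) (Fin n) ℝ) : Prop where
  stochastic : ∀ k, A k ∈ Matrix.rowStochastic ℝ (Fin n)
  loop_pos : ∀ k i, 0 < A k i i
  exists_lower : ∃ η > 0, ∀ k i j, 0 < A k i j → η ≤ A k i j
  ujsc : UJSC A

namespace ConsensusWeights

theorem nonneg (hA : ConsensusWeights A) (k : ℕ) (i j : Fin n) : 0 ≤ A k i j :=
  (hA.stochastic k).1 i j

theorem shift (hA : ConsensusWeights A) (s : ℕ) : ConsensusWeights fun k => A (s + k) where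
  stochastic k := hA.stochastic _
  loop_pos k := hA.loop_pos _
  exists_lower := hA.exists_lower.imp fun _ hη => ⟨hη.1, fun k => hη.2 (s + k)⟩
  ujsc := by
    obtain ⟨T, hT, hconn⟩ := hA.ujsc
    refine ⟨T, hT, fun k i j => Relation.ReflTransGen.mono ?_ _ _ (hconn (s + k) i j)⟩
    rintro a b ⟨t, hkt, htT, hab⟩
    obtain ⟨u, rfl⟩ : ∃ u, t = s + u := ⟨t - s, by omega⟩
    exact ⟨u, by omega, by omega, hab⟩

theorem exists_stepProd_lower (hA : ConsensusWeights A) :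
    ∃ W > 0, ∃ δ > 0, ∀ s i j, δ ≤ stepProd A s W i j := by
  obtain ⟨η, hη, hlower⟩ := hA.exists_lower
  obtain ⟨W, hW_pos, hW⟩ := exists_forall_stepProd_pos hA.nonneg hA.loop_pos hA.ujsc
  exact ⟨W, hW_pos, η ^ W, pow_pos hη W,
    fun s i j => pow_le_stepProd hη.le hA.nonneg hlower (hW s i j)⟩

end ConsensusWeights

end Connectivity

/-! ### Consensus -/

section Consensus

theorem norm_sum_smul_sub_sum_smul_le {ι E : Type*} [Fintype ι] [SeminormedAddCommGroup E]
    [NormedSpace ℝ E] {p q : ι → ℝ} {δ : ℝ} (hδ : 0 ≤ δ) (hp : p ∈ stdSimplex ℝ ι)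
    (hq : ∀ j, δ ≤ q j) (hq_sum : ∑ j, q j = 1) {x : ι → E} {D : ℝ}
    (hD : ∀ i j, ‖x i - x j‖ ≤ D) : ‖∑ j, p j • x j - ∑ j, q j • x j‖ ≤ (1 - δ) * D := by
  classical
  rcases isEmpty_or_nonempty ι with _ | ⟨⟨i⟩⟩
  · simp at hq_sum
  have hD_nonneg : 0 ≤ D := (norm_nonneg _).trans (hD i i)
  have hcoupling : ∑ j, p j • x j - ∑ j, q j • x j = ∑ j, ∑ l, (p j * q l) • (x j - x l) := by
    simp only [smul_sub, Finset.sum_sub_distrib]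
    congr 1
    · simp only [← Finset.sum_smul, ← Finset.mul_sum, hq_sum, mul_one]
    · rw [Finset.sum_comm]
      simp only [← Finset.sum_smul, ← Finset.sum_mul, hp.2, one_mul]
  -- The coupling leaves the mass `∑ j, p j * q j ≥ δ` in place.
  have hterm (j l : ι) : ‖(p j * q l) • (x j - x l)‖ ≤
      p j * q l * D - if j = l then p j * q l * D else 0 := by
    have hpq : 0 ≤ p j * q l := mul_nonneg (hp.1 j) (hδ.trans (hq l))
    split_ifs with hjl
    · simp [hjl]
    · rw [norm_smul, Real.norm_of_nonneg hpq, sub_zero]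
      exact mul_le_mul_of_nonneg_left (hD j l) hpq
  calc ‖∑ j, p j • x j - ∑ j, q j • x j‖
      ≤ ∑ j, ∑ l, (p j * q l * D - if j = l then p j * q l * D else 0) := by
        rw [hcoupling]
        exact norm_sum_le_of_le _ fun j _ => norm_sum_le_of_le _ fun l _ => hterm j l
    _ = D - ∑ j, p j * q j * D := by
        simp [Finset.sum_sub_distrib, ← Finset.sum_mul, ← Finset.mul_sum, hq_sum, hp.2]
    _ ≤ D - ∑ j, p j * δ * D := by
        gcongr with j
        exacts [hp.1 j, hq j]
    _ = (1 - δ) * D := by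
        rw [← Finset.sum_mul, ← Finset.sum_mul, hp.2]
        ring

theorem le_add_pow_mul_of_contraction {D : ℕ → ℝ} {W K : ℕ} {ρ θ : ℝ} (hρ : 0 ≤ ρ) (hθ : 0 ≤ θ)
    (h : ∀ k ≥ K, D (k + W) ≤ ρ * D k + (1 - ρ) * θ) {k : ℕ} (hk : K ≤ k) (m : ℕ) :
    D (k + m * W) ≤ θ + ρ ^ m * D k := by
  induction m with
  | zero => simpa using hθ
  | succ m ih =>
    calc D (k + (m + 1) * W) = D (k + m * W + W) := by ring_nf
      _ ≤ ρ * D (k + m * W) + (1 - ρ) * θ := h _ (by omega)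
      _ ≤ ρ * (θ + ρ ^ m * D k) + (1 - ρ) * θ := by gcongr
      _ = θ + ρ ^ (m + 1) * D k := by ring

theorem tendsto_zero_of_contraction {D ε : ℕ → ℝ} {W : ℕ} (hW : 0 < W) {ρ : ℝ} (hρ : 0 ≤ ρ)
    (hρ_lt : ρ < 1) (hD : ∀ k, 0 ≤ D k) (hε : Tendsto ε atTop (𝓝 0))
    (h : ∀ k, D (k + W) ≤ ρ * D k + ε k) : Tendsto D atTop (𝓝 0) := by
  rw [Metric.tendsto_atTop]
  intro θ hθ
  have hθ' : 0 < (1 - ρ) * (θ / 2) := mul_pos (sub_pos.2 hρ_lt) (half_pos hθ)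
  obtain ⟨K, hK⟩ := eventually_atTop.1 (hε.eventually_le_const hθ')
  have hdecay : ∀ r ∈ Finset.range W, ∀ᶠ m in atTop, ρ ^ m * D (K + r) < θ / 2 := fun r _ => by
    have hlim := (tendsto_pow_atTop_nhds_zero_of_lt_one hρ hρ_lt).mul_const (D (K + r))
    exact hlim.eventually_lt_const (by simpa using half_pos hθ)
  obtain ⟨m₀, hm₀⟩ := eventually_atTop.1 ((Filter.eventually_all_finset _).2 hdecay)
  refine ⟨K + m₀ * W, fun k hk => ?_⟩
  obtain ⟨r, hr, m, hm, rfl⟩ : ∃ r < W, ∃ m ≥ m₀, k = K + r + m * W :=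
    ⟨(k - K) % W, Nat.mod_lt _ hW, (k - K) / W, (Nat.le_div_iff_mul_le hW).2 (by omega), by
      have := Nat.mod_add_div' (k - K) W
      omega⟩
  have hgeom := le_add_pow_mul_of_contraction (D := D) (W := W) (K := K) hρ (half_pos hθ).le
    (fun k hk => (h k).trans (by gcongr; exact hK k hk)) (Nat.le_add_right K r) m
  rw [Real.dist_0_eq_abs, abs_of_nonneg (hD _)]
  linarith [hm₀ m hm r (Finset.mem_range.2 hr)]

variable {ι E : Type*} [Fintype ι] [DecidableEq ι] [SeminormedAddCommGroup E] [NormedSpace ℝ E]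

theorem norm_sub_stepProd_smul_le {A : ℕ → Matrix ι ι ℝ}
    (hA : ∀ k, A k ∈ Matrix.rowStochastic ℝ ι) {x e : ℕ → ι → E}
    (hx : ∀ k i, x (k + 1) i = ∑ j, A k i j • x k j + e k i) (k w : ℕ) (i : ι) :
    ‖x (k + w) i - ∑ j, stepProd A k w i j • x k j‖ ≤
      ∑ t ∈ Finset.range w, ∑ i, ‖e (k + t) i‖ := by
  induction w generalizing i with
  | zero => simp [stepProd, Matrix.one_apply]
  | succ w ih =>
    have hstep : x (k + (w + 1)) i - ∑ j, stepProd A k (w + 1) i j • x k j =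
        ∑ l, A (k + w) i l • (x (k + w) l - ∑ j, stepProd A k w l j • x k j) + e (k + w) i := by
      rw [← add_assoc, hx]
      simp only [stepProd, Matrix.mul_apply, Finset.sum_smul, smul_sub, Finset.sum_sub_distrib,
        Finset.smul_sum, smul_smul]
      rw [Finset.sum_comm]
      abel
    rw [hstep, Finset.sum_range_succ]
    refine norm_add_le_of_le ?_ (Finset.single_le_sum (f := fun i => ‖e (k + w) i‖)
      (fun _ _ => norm_nonneg _) (Finset.mem_univ i))
    calc ‖∑ l, A (k + w) i l • (x (k + w) l - ∑ j, stepProd A k w l j • x k j)‖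
        ≤ ∑ l, A (k + w) i l * ∑ t ∈ Finset.range w, ∑ i, ‖e (k + t) i‖ := by
          refine norm_sum_le_of_le _ fun l _ => ?_
          rw [norm_smul, Real.norm_of_nonneg ((hA _).1 i l)]
          exact mul_le_mul_of_nonneg_left (ih l) ((hA _).1 i l)
      _ = ∑ t ∈ Finset.range w, ∑ i, ‖e (k + t) i‖ := by
          rw [← Finset.sum_mul, Matrix.sum_row_of_mem_rowStochastic (hA _), one_mul]

theorem norm_sub_le_of_le_stepProd {A : ℕ → Matrix ι ι ℝ}
    (hA : ∀ k, A k ∈ Matrix.rowStochastic ℝ ι) {x e : ℕ → ι → E}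
    (hx : ∀ k i, x (k + 1) i = ∑ j, A k i j • x k j + e k i) {k W : ℕ} {δ D : ℝ} (hδ : 0 ≤ δ)
    (hP : ∀ i j, δ ≤ stepProd A k W i j) (hD : ∀ i j, ‖x k i - x k j‖ ≤ D) (i j : ι) :
    ‖x (k + W) i - x (k + W) j‖ ≤
      (1 - δ) * D + 2 * ∑ t ∈ Finset.range W, ∑ i, ‖e (k + t) i‖ := by
  have hstoch := stepProd_mem_rowStochastic hA k W
  have hrow := Matrix.sum_row_of_mem_rowStochastic hstoch
  have havg := norm_sum_smul_sub_sum_smul_le hδ ⟨hstoch.1 i, hrow i⟩ (hP j) (hrow j) hD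
  have hi := norm_sub_stepProd_smul_le hA hx k W i
  have hj := norm_sub_stepProd_smul_le hA hx k W j
  set avg := fun i => ∑ l, stepProd A k W i l • x k l
  calc ‖x (k + W) i - x (k + W) j‖
      = ‖(x (k + W) i - avg i) + (avg i - avg j) - (x (k + W) j - avg j)‖ := by congr 1; abel
    _ ≤ ‖x (k + W) i - avg i‖ + ‖avg i - avg j‖ + ‖x (k + W) j - avg j‖ :=
        (norm_sub_le _ _).trans (by gcongr; exact norm_add_le _ _)
    _ ≤ (1 - δ) * D + 2 * ∑ t ∈ Finset.range W, ∑ i, ‖e (k + t) i‖ := by linarith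

theorem ConsensusWeights.tendsto_sub {n : ℕ} {A : ℕ → Matrix (Fin n) (Fin n) ℝ}
    (hA : ConsensusWeights A) {x e : ℕ → Fin n → E}
    (hx : ∀ k i, x (k + 1) i = ∑ j, A k i j • x k j + e k i)
    (he : ∀ i, Tendsto (fun k => e k i) atTop (𝓝 0)) (i j : Fin n) :
    Tendsto (fun k => x k i - x k j) atTop (𝓝 0) := by
  obtain ⟨W, hW, δ, hδ, hP⟩ := hA.exists_stepProd_lower
  have hδ_le : δ ≤ 1 := (hP 0 i i).trans
    (Matrix.le_one_of_mem_rowStochastic (stepProd_mem_rowStochastic hA.stochastic 0 W))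
  set D : ℕ → ℝ := fun k => ‖fun p : Fin n × Fin n => x k p.1 - x k p.2‖
  have hle (k : ℕ) (i j : Fin n) : ‖x k i - x k j‖ ≤ D k :=
    norm_le_pi_norm (fun p : Fin n × Fin n => x k p.1 - x k p.2) (i, j)
  have hdisturbance :
      Tendsto (fun k => 2 * ∑ t ∈ Finset.range W, ∑ i, ‖e (k + t) i‖) atTop (𝓝 0) := by
    have hterm (t : ℕ) (i : Fin n) : Tendsto (fun k => ‖e (k + t) i‖) atTop (𝓝 0) := by
      simpa using ((tendsto_add_atTop_iff_nat t).2 (he i)).norm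
    simpa using (tendsto_finsetSum (Finset.range W) fun t _ =>
      tendsto_finsetSum Finset.univ fun i _ => hterm t i).const_mul 2
  have hD : Tendsto D atTop (𝓝 0) := by
    refine tendsto_zero_of_contraction hW (sub_nonneg.2 hδ_le) (sub_lt_self 1 hδ)
      (fun _ => norm_nonneg _) hdisturbance fun k => ?_
    have hbound := norm_sub_le_of_le_stepProd hA.stochastic hx hδ.le (hP k) (hle k)
    exact (pi_norm_le_iff_of_nonneg ((norm_nonneg _).trans (hbound i i))).2
      fun p => hbound p.1 p.2
  exact squeeze_zero_norm (fun k => hle k i j) hD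

end Consensus

/-! ### Perron vectors -/

section Perron

theorem transition_of_lt {n : ℕ} (A : ℕ → Matrix (Fin n) (Fin n) ℝ) {s k : ℕ} (h : k < s) :
    transition A s k = 1 := by
  cases k with
  | zero => simp [transition, h.ne']
  | succ k => simp [transition, h]

theorem transition_add {n : ℕ} (A : ℕ → Matrix (Fin n) (Fin n) ℝ) (s w : ℕ) :
    transition A s (s + w) = stepProd A s (w + 1) := by
  induction w with
  | zero =>
    cases s with
    | zero => simp [transition, stepProd]
    | succ s => simp [transition, stepProd, transition_of_lt]
  | succ w ih => rw [← add_assoc, transition, ih, if_pos (by omega), add_assoc, ← stepProd]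

theorem abs_stepProd_sub_stepProd_add_le {ι : Type*} [Fintype ι] [DecidableEq ι]
    {A : ℕ → Matrix ι ι ℝ} (hA : ∀ k, A k ∈ Matrix.rowStochastic ℝ ι) (s v w : ℕ) (i j : ι) :
    |stepProd A s v i j - stepProd A s (v + w) i j| ≤
      ∑ l, |stepProd A s v i j - stepProd A s v l j| := by
  have hstoch := stepProd_mem_rowStochastic hA (s + v) w
  have hdiff : stepProd A s v i j - stepProd A s (v + w) i j =
      ∑ l, stepProd A (s + v) w i l * (stepProd A s v i j - stepProd A s v l j) := by
    rw [stepProd_add, Matrix.mul_apply]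
    simp only [mul_sub, Finset.sum_sub_distrib, ← Finset.sum_mul,
      Matrix.sum_row_of_mem_rowStochastic hstoch, one_mul]
  rw [hdiff]
  refine (Finset.abs_sum_le_sum_abs _ _).trans (Finset.sum_le_sum fun l _ => ?_)
  rw [abs_mul, abs_of_nonneg (hstoch.1 i l)]
  exact mul_le_of_le_one_left (abs_nonneg _) (Matrix.le_one_of_mem_rowStochastic hstoch)

variable {n : ℕ} {A : ℕ → Matrix (Fin n) (Fin n) ℝ}

theorem isPerronLimit_iff_tendsto_stepProd {s : ℕ} {φ : Fin n → ℝ} :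
    IsPerronLimit A s φ ↔ ∀ i j, Tendsto (fun w => stepProd A s w i j) atTop (𝓝 (φ j)) := by
  refine forall₂_congr fun i j => ?_
  rw [← tendsto_add_atTop_iff_nat s,
    ← tendsto_add_atTop_iff_nat (f := fun w => stepProd A s w i j) 1]
  refine tendsto_congr fun w => ?_
  rw [add_comm w s, transition_add]

theorem IsPerronLimit.tendsto_stepProd {s : ℕ} {φ : Fin n → ℝ} (hφ : IsPerronLimit A s φ)
    (i j : Fin n) : Tendsto (fun w => stepProd A s w i j) atTop (𝓝 (φ j)) :=
  isPerronLimit_iff_tendsto_stepProd.1 hφ i j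

theorem IsPerronLimit.unique {s : ℕ} {φ ψ : Fin n → ℝ} (hφ : IsPerronLimit A s φ)
    (hψ : IsPerronLimit A s ψ) : φ = ψ :=
  funext fun j => tendsto_nhds_unique (hφ j j) (hψ j j)

theorem IsPerronLimit.mem_stdSimplex [Nonempty (Fin n)]
    (hA : ∀ k, A k ∈ Matrix.rowStochastic ℝ (Fin n)) {s : ℕ} {φ : Fin n → ℝ}
    (hφ : IsPerronLimit A s φ) : φ ∈ stdSimplex ℝ (Fin n) := by
  have hstoch (w : ℕ) := stepProd_mem_rowStochastic hA s w
  refine ⟨fun j => ge_of_tendsto' (hφ.tendsto_stepProd j j) fun w => (hstoch w).1 j j, ?_⟩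
  obtain ⟨i⟩ := ‹Nonempty (Fin n)›
  refine tendsto_nhds_unique
    (tendsto_finsetSum Finset.univ fun j _ => hφ.tendsto_stepProd i j) ?_
  simp only [Matrix.sum_row_of_mem_rowStochastic (hstoch _), tendsto_const_nhds]

theorem IsPerronLimit.eq_vecMul {s : ℕ} {φ ψ : Fin n → ℝ} (hφ : IsPerronLimit A s φ)
    (hψ : IsPerronLimit A (s + 1) ψ) : φ = Matrix.vecMul ψ (A s) := by
  funext j
  have hprod := tendsto_finsetSum Finset.univ fun i _ =>
    (hψ.tendsto_stepProd j i).mul_const (A s i j)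
  refine tendsto_nhds_unique ((tendsto_add_atTop_iff_nat 1).2 (hφ.tendsto_stepProd j j))
    (hprod.congr fun w => ?_)
  rw [stepProd_succ', Matrix.mul_apply]

namespace ConsensusWeights

theorem tendsto_stepProd_sub (hA : ConsensusWeights A) (s : ℕ) (i l j : Fin n) :
    Tendsto (fun w => stepProd A s w i j - stepProd A s w l j) atTop (𝓝 0) := by
  refine (hA.shift s).tendsto_sub (x := fun w i => stepProd A s w i j)
    (e := fun _ _ => 0) (fun k i => ?_) (fun _ => tendsto_const_nhds) i l
  simp [stepProd, Matrix.mul_apply]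

theorem exists_isPerronLimit (hA : ConsensusWeights A) (s : ℕ) : ∃ φ, IsPerronLimit A s φ := by
  have hlim (j : Fin n) : ∃ a, Tendsto (fun w => stepProd A s w j j) atTop (𝓝 a) := by
    refine cauchySeq_tendsto_of_complete (cauchySeq_of_le_tendsto_0'
      (fun w => ∑ l, |stepProd A s w j j - stepProd A s w l j|) (fun v w hvw => ?_) ?_)
    · obtain ⟨u, rfl⟩ := Nat.exists_eq_add_of_le hvw
      exact abs_stepProd_sub_stepProd_add_le hA.stochastic s v u j j
    · simpa using tendsto_finsetSum Finset.univ fun l _ => (hA.tendsto_stepProd_sub s j l j).abs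
  choose φ hφ using hlim
  refine ⟨φ, isPerronLimit_iff_tendsto_stepProd.2 fun i j => ?_⟩
  simpa using (hA.tendsto_stepProd_sub s i j j).add (hφ j)

theorem exists_perron_lower (hA : ConsensusWeights A) :
    ∃ c > 0, ∀ s φ, IsPerronLimit A s φ → ∀ j, c ≤ φ j := by
  obtain ⟨W, -, δ, hδ, hP⟩ := hA.exists_stepProd_lower
  refine ⟨δ, hδ, fun s φ hφ j => ?_⟩
  refine ge_of_tendsto' ((tendsto_add_atTop_iff_nat W).2 (hφ.tendsto_stepProd j j)) fun w => ?_
  have hstoch := stepProd_mem_rowStochastic hA.stochastic (s + W) w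
  calc δ = ∑ l, stepProd A (s + W) w j l * δ := by
        rw [← Finset.sum_mul, Matrix.sum_row_of_mem_rowStochastic hstoch, one_mul]
    _ ≤ ∑ l, stepProd A (s + W) w j l * stepProd A s W l j :=
        Finset.sum_le_sum fun l _ => mul_le_mul_of_nonneg_left (hP s l j) (hstoch.1 j l)
    _ = stepProd A s (w + W) j j := by rw [add_comm w, stepProd_add, Matrix.mul_apply]

end ConsensusWeights

end Perron

/-! ### The estimators -/

section Estimators

variable {n : ℕ} {A A' : ℕ → Matrix (Fin n) (Fin n) ℝ}

theorem neighbors_congr {n m : ℕ} {M M' : Matrix (Fin n) (Fin m) ℝ} {i : Fin n}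
    (h : ∀ j ∈ neighbors M i ∪ neighbors M' i, M i j = M' i j) :
    neighbors M i = neighbors M' i := by
  ext j
  constructor <;> intro hj
  · simpa [neighbors, h j (Finset.mem_union_left _ hj)] using hj
  · simpa [neighbors, h j (Finset.mem_union_right _ hj)] using hj

theorem auxState_congr_of_sameInfo (t s : ℕ) (i : Fin n) (h : SameInfo A A' s i) :
    auxState A t s i = auxState A' t s i := by
  induction s generalizing i with
  | zero => rfl
  | succ s ih =>
    obtain ⟨-, hweights, hstates⟩ := h
    funext j
    simp only [auxState, ← neighbors_congr hweights]
    congr 1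
    refine Finset.sum_congr rfl fun l hl => ?_
    rw [hweights l (Finset.mem_union_left _ hl), ih l (hstates l hl)]

theorem isDistributed_consensusEstimator (n : ℕ) : IsDistributed (consensusEstimator n) :=
  fun _ _ k i h => congrFun (auxState_congr_of_sameInfo 0 k i h.1) i

theorem isDistributed_periodicEstimator (n p : ℕ) : IsDistributed (periodicEstimator n p) :=
  fun _ _ k i h => congrFun (auxState_congr_of_sameInfo (k % p + 1) k i h.1) i

theorem auxState_eq_stepProd (hA : ∀ k i j, 0 ≤ A k i j) (t s : ℕ) (i j : Fin n) :
    auxState A t s i j = stepProd A t (s - t) i j := by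
  induction s generalizing i with
  | zero => simp [auxState, stepProd, Matrix.one_apply, eq_comm]
  | succ s ih =>
    rw [auxState]
    split_ifs with hst
    · simp [Nat.sub_eq_zero_of_le hst, stepProd, Matrix.one_apply, eq_comm]
    · rw [Nat.succ_sub (by omega), stepProd, Matrix.mul_apply, Nat.add_sub_cancel' (by omega)]
      simp only [ih]
      exact sum_neighbors_smul (hA s) (fun l => stepProd A t (s - t) l j) i

theorem auxState_self_pos (hA : ConsensusWeights A) (t s : ℕ) (i : Fin n) :
    0 < auxState A t s i i := by
  rw [auxState_eq_stepProd hA.nonneg]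
  exact stepProd_diag_pos hA.nonneg hA.loop_pos _ _ _

theorem IsPerronLimit.sum_mul_eq_of_vecMul_eq {v φ : Fin n → ℝ}
    (hv : ∀ k, Matrix.vecMul v (A k) = v) {s : ℕ} (hφ : IsPerronLimit A s φ) (j : Fin n) :
    (∑ i, v i) * φ j = v j := by
  have hlim := tendsto_finsetSum Finset.univ fun i _ => (hφ.tendsto_stepProd i j).const_mul (v i)
  have hconst (w : ℕ) : ∑ i, v i * stepProd A s w i j = v j := congrFun (vecMul_stepProd hv s w) j
  simp only [hconst, ← Finset.sum_mul] at hlim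
  exact tendsto_nhds_unique hlim tendsto_const_nhds

theorem IsPerronLimit.eq_of_hasCommonLeftEigenvector (hA : HasCommonLeftEigenvector A) {s t : ℕ}
    {φ ψ : Fin n → ℝ} (hφ : IsPerronLimit A s φ) (hψ : IsPerronLimit A t ψ) : φ = ψ := by
  obtain ⟨v, hv_ne, hv⟩ := hA
  have hsum : ∑ i, v i ≠ 0 := fun hzero =>
    hv_ne (funext fun j => by simp [← hφ.sum_mul_eq_of_vecMul_eq hv j, hzero])
  exact funext fun j => mul_left_cancel₀ hsum <|
    (hφ.sum_mul_eq_of_vecMul_eq hv j).trans (hψ.sum_mul_eq_of_vecMul_eq hv j).symm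

theorem learnsPerron_consensusEstimator (hA : ConsensusWeights A)
    (hcommon : HasCommonLeftEigenvector A) : LearnsPerron A (consensusEstimator n) := by
  choose φ hφ using hA.exists_isPerronLimit
  refine ⟨fun k i => auxState_self_pos hA 0 k i, φ, hφ, fun i => ?_⟩
  have hconst (k : ℕ) : φ (k + 1) = φ 0 := (hφ _).eq_of_hasCommonLeftEigenvector hcommon (hφ 0)
  simp only [consensusEstimator, auxState_eq_stepProd hA.nonneg, Nat.sub_zero, hconst]
  simpa using ((hφ 0).tendsto_stepProd i i).sub_const (φ 0 i)

theorem SwitchesPeriodically.periodic {p : ℕ} (hA : SwitchesPeriodically A p) :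
    Function.Periodic A p := by
  obtain ⟨hp, S, -, hS⟩ := hA
  have hmod (k : ℕ) : A k = S ⟨k % p, Nat.mod_lt k hp⟩ := by
    rw [← hS (k / p), Nat.div_add_mod']
  intro k
  simp only [hmod, Nat.add_mod_right]

theorem periodic_of_isPerronLimit {p : ℕ} (hA : Function.Periodic A p) {φ : ℕ → Fin n → ℝ}
    (hφ : ∀ s, IsPerronLimit A s (φ s)) : Function.Periodic φ p := fun s =>
  (hφ _).unique <| isPerronLimit_iff_tendsto_stepProd.2 fun i j => by
    simpa only [stepProd_add_period hA] using (hφ s).tendsto_stepProd i j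

theorem learnsPerron_periodicEstimator (hA : ConsensusWeights A) {p : ℕ}
    (hperiodic : SwitchesPeriodically A p) : LearnsPerron A (periodicEstimator n p) := by
  choose φ hφ using hA.exists_isPerronLimit
  refine ⟨fun k i => auxState_self_pos hA _ k i, φ, hφ, fun i => ?_⟩
  rw [Metric.tendsto_atTop]
  intro ε hε
  have hclose : ∀ ν ∈ Finset.range p, ∀ᶠ w in atTop,
      dist (stepProd A (ν + 1) w i i) (φ (ν + 1) i) < ε := fun ν _ =>
    ((hφ (ν + 1)).tendsto_stepProd i i).eventually (Metric.ball_mem_nhds _ hε)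
  obtain ⟨W, hW⟩ := eventually_atTop.1 ((Filter.eventually_all_finset _).2 hclose)
  refine ⟨W + p, fun k hk => ?_⟩
  have hν : k % p < p := Nat.mod_lt _ hperiodic.1
  have hφ_mod : φ (k + 1) = φ (k % p + 1) :=
    (((periodic_of_isPerronLimit hperiodic.periodic hφ).add_const 1).map_mod_nat k).symm
  rw [dist_zero_right, Real.norm_eq_abs, periodicEstimator, auxState_eq_stepProd hA.nonneg,
    hφ_mod, ← Real.dist_eq]
  exact hW (k - (k % p + 1)) (by omega) (k % p) (Finset.mem_range.2 hν)

end Estimators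

/-! ### Subgradients and projections -/

theorem exists_strongDual_add_le_of_convexOn {E : Type*} [NormedAddCommGroup E] [NormedSpace ℝ E]
    {φ : E → ℝ} (hφ : ConvexOn ℝ Set.univ φ) (hcont : Continuous φ) (z : E) :
    ∃ ℓ : StrongDual ℝ E, ∀ w, φ z + ℓ (w - z) ≤ φ w := by
  have hopen : IsOpen {p : E × ℝ | p.1 ∈ Set.univ ∧ φ p.1 < p.2} := by
    simpa using isOpen_lt (hcont.comp continuous_fst) continuous_snd
  obtain ⟨ℓ, hℓ⟩ := geometric_hahn_banach_open_point hφ.convex_strict_epigraph hopen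
    (x := (z, φ z)) (by simp)
  have hsplit : ∀ x t, ℓ (x, t) = ℓ (x, 0) + t * ℓ (0, 1) := fun x t => by
    rw [← smul_eq_mul, ← map_smul, ← map_add]
    simp
  have hslope : 0 < -ℓ (0, 1) := by
    have h := hℓ (z, φ z + 1) (by simp)
    rw [hsplit z (φ z + 1), hsplit z (φ z)] at h
    linarith
  refine ⟨(-ℓ (0, 1))⁻¹ • ℓ.comp (ContinuousLinearMap.inl ℝ E ℝ), fun w => ?_⟩
  suffices h : ℓ (w - z, 0) ≤ -ℓ (0, 1) * (φ w - φ z) by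
    have := (inv_mul_le_iff₀ hslope).2 h
    simpa [add_comm, ← le_sub_iff_add_le] using this
  refine le_of_forall_pos_le_add fun ε hε => ?_
  have hsep := hℓ (w, φ w + ε / -ℓ (0, 1)) (by simpa using div_pos hε hslope)
  rw [hsplit w, hsplit z] at hsep
  have hsub : ℓ (w - z, 0) = ℓ (w, 0) - ℓ (z, 0) := by rw [← map_sub]; simp
  have hcancel : ε / -ℓ (0, 1) * ℓ (0, 1) = -ε := by
    rw [div_neg, neg_mul, div_mul_cancel₀ _ (neg_pos.1 hslope).ne]
  linarith

section Subgradients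

variable {m : ℕ} {φ : Euc m → ℝ} {K : Set (Euc m)}

theorem convexSubdiff_nonempty (hφ : ConvexOn ℝ Set.univ φ) (z : Euc m) :
    (convexSubdiff φ z).Nonempty := by
  obtain ⟨ℓ, hℓ⟩ := exists_strongDual_add_le_of_convexOn hφ hφ.locallyLipschitz.continuous z
  refine ⟨(InnerProductSpace.toDual ℝ (Euc m)).symm ℓ, fun w => ?_⟩
  rw [real_inner_comm, InnerProductSpace.toDual_symm_apply]
  exact hℓ w

theorem abs_sub_le_of_subgradients_bounded (hφ : ConvexOn ℝ Set.univ φ) {L : ℝ}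
    (hL : ∀ x ∈ K, ∀ q ∈ convexSubdiff φ x, ‖q‖ ≤ L) {x x' : Euc m} (hx : x ∈ K) (hx' : x' ∈ K) :
    |φ x - φ x'| ≤ L * ‖x - x'‖ := by
  have hle : ∀ u ∈ K, ∀ v, φ u - φ v ≤ L * ‖u - v‖ := fun u hu v => by
    obtain ⟨q, hq⟩ := convexSubdiff_nonempty hφ u
    calc φ u - φ v ≤ inner ℝ (u - v) q := by
          have := hq v
          rw [← neg_sub u v, inner_neg_left] at this
          linarith
      _ ≤ ‖u - v‖ * ‖q‖ := real_inner_le_norm _ _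
      _ ≤ L * ‖u - v‖ := by
          rw [mul_comm]
          gcongr
          exact hL u hu q hq
  refine abs_sub_le_iff.2 ⟨hle x hx x', ?_⟩
  rw [norm_sub_rev]
  exact hle x' hx' x

theorem IsProjection.norm_sub_le (hK : Convex ℝ K) {z p w : Euc m} (hp : IsProjection K z p)
    (hw : w ∈ K) : ‖p - w‖ ≤ ‖z - w‖ := by
  have hne : Nonempty K := ⟨⟨w, hw⟩⟩
  have hbdd : BddBelow (Set.range fun w : K => ‖z - w‖) :=
    ⟨0, by rintro _ ⟨w, rfl⟩; exact norm_nonneg _⟩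
  have hinf : ‖z - p‖ = ⨅ w : K, ‖z - w‖ :=
    le_antisymm (le_ciInf fun w => hp.2 w w.2) (ciInf_le hbdd ⟨p, hp.1⟩)
  have hobtuse := (norm_eq_iInf_iff_real_inner_le_zero hK hp.1).1 hinf w hw
  have hexpand : ‖z - w‖ ^ 2 = ‖z - p‖ ^ 2 - 2 * inner ℝ (z - p) (w - p) + ‖p - w‖ ^ 2 := by
    rw [← sub_sub_sub_cancel_right z w p, norm_sub_sq_real, norm_sub_rev w p]
  refine le_of_sq_le_sq ?_ (norm_nonneg _)
  linarith [sq_nonneg ‖z - p‖]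

theorem norm_sub_sq_le_of_subgradient_step (hK : Convex ℝ K) {u q p z : Euc m} {a : ℝ}
    (ha : 0 ≤ a) (hq : q ∈ convexSubdiff φ u) (hp : IsProjection K (u - a • q) p) (hz : z ∈ K) :
    ‖p - z‖ ^ 2 ≤ ‖u - z‖ ^ 2 - 2 * a * (φ u - φ z) + a ^ 2 * ‖q‖ ^ 2 := by
  have hdescent : φ u - φ z ≤ inner ℝ (u - z) q := by
    have := hq z
    rw [← neg_sub u z, inner_neg_left] at this
    linarith
  calc ‖p - z‖ ^ 2 ≤ ‖u - a • q - z‖ ^ 2 := by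
        gcongr
        exact hp.norm_sub_le hK hz
    _ = ‖u - z‖ ^ 2 - 2 * a * inner ℝ (u - z) q + a ^ 2 * ‖q‖ ^ 2 := by
        rw [sub_right_comm, norm_sub_sq_real, inner_smul_right, norm_smul, mul_pow,
          Real.norm_eq_abs, sq_abs]
        ring
    _ ≤ _ := by gcongr

end Subgradients

/-! ### Growth of convex and concave functions -/

section Growth

variable {E F : Type*} [NormedAddCommGroup E] [NormedAddCommGroup F] [NormedSpace ℝ F]

theorem exists_relative_ball [FiniteDimensional ℝ F] {K : Set F} (hK : Convex ℝ K)
    (hne : K.Nonempty) :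
    ∃ y₀ ∈ K, ∃ r > 0,
      ∀ y ∈ K, ∀ y' ∈ K, ∀ c : ℝ, ‖c • (y' - y)‖ ≤ r → y₀ + c • (y' - y) ∈ K := by
  obtain ⟨y₀, hy₀⟩ := hne.intrinsicInterior hK
  obtain ⟨⟨y₁, hy₁⟩, hy₁int, rfl⟩ := mem_intrinsicInterior.1 hy₀
  obtain ⟨r, hr, hball⟩ := Metric.mem_nhds_iff.1 (mem_interior_iff_mem_nhds.1 hy₁int)
  refine ⟨y₁, intrinsicInterior_subset hy₀, r / 2, half_pos hr, fun y hy y' hy' c hc => ?_⟩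
  have hdir : c • (y' - y) ∈ (affineSpan ℝ K).direction :=
    Submodule.smul_mem _ _ (AffineSubspace.vsub_mem_direction (subset_affineSpan ℝ K hy')
      (subset_affineSpan ℝ K hy))
  have hspan : y₁ + c • (y' - y) ∈ affineSpan ℝ K := by
    have := AffineSubspace.vadd_mem_of_mem_direction hdir hy₁
    rwa [vadd_eq_add, add_comm] at this
  have hmem : (⟨y₁ + c • (y' - y), hspan⟩ : affineSpan ℝ K) ∈
      Metric.ball (⟨y₁, hy₁⟩ : affineSpan ℝ K) r := by
    rw [Metric.mem_ball, Subtype.dist_eq, dist_eq_norm, add_sub_cancel_left]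
    linarith
  exact hball hmem

theorem exists_crossing_segments [FiniteDimensional ℝ F] {K : Set F} (hK : Convex ℝ K)
    (hne : K.Nonempty) :
    ∃ y₀ ∈ K, ∃ r > 0, ∀ y ∈ K, ∀ y' ∈ K, ∃ t : ℝ, 0 ≤ t ∧ t ≤ 1 ∧ t ≤ ‖y - y'‖ / r ∧
      ∃ w ∈ K, ‖w - y₀‖ ≤ r ∧ (1 - t) • y + t • w = (1 - t) • y' + t • y₀ := by
  obtain ⟨y₀, hy₀, r, hr, hball⟩ := exists_relative_ball hK hne
  refine ⟨y₀, hy₀, r, hr, fun y hy y' hy' => ?_⟩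
  rcases eq_or_ne y y' with rfl | hyy'
  · exact ⟨0, le_rfl, zero_le_one, by simp, y₀, hy₀, by simpa using hr.le, rfl⟩
  set ε := ‖y - y'‖ with hε
  have hε0 : 0 < ε := norm_sub_pos_iff.2 hyy'
  have hw : ‖(r / ε) • (y' - y)‖ = r := by
    rw [norm_smul, Real.norm_of_nonneg (by positivity), norm_sub_rev, ← hε,
      div_mul_cancel₀ _ hε0.ne']
  refine ⟨ε / (r + ε), by positivity, by rw [div_le_one (by positivity)]; linarith,
    by gcongr; linarith, y₀ + (r / ε) • (y' - y), hball y hy y' hy' _ hw.le,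
    by rw [add_sub_cancel_left, hw], ?_⟩
  have hcoeff : ε / (r + ε) * (r / ε) = 1 - ε / (r + ε) := by field_simp; ring
  rw [smul_add, smul_smul, hcoeff, smul_sub]
  abel

theorem sub_le_mul_of_concaveOn {K : Set F} {φ : F → ℝ} (hφ : ConcaveOn ℝ K φ) {y w : F}
    (hy : y ∈ K) (hw : w ∈ K) {t R : ℝ} (ht0 : 0 ≤ t) (ht1 : t ≤ 1) (hR : φ y - φ w ≤ R) :
    φ y - φ ((1 - t) • y + t • w) ≤ t * R := by
  have hconcave := hφ.2 hy hw (sub_nonneg.2 ht1) ht0 (sub_add_cancel 1 t)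
  rw [smul_eq_mul, smul_eq_mul] at hconcave
  linarith [mul_le_mul_of_nonneg_left hR ht0]

/-- A steep descent of one summand from `y` to `y'` would have to be compensated by a steep ascent
of another one, which its concavity excludes. -/
theorem sub_le_of_concaveOn_of_sum_lipschitz {ι : Type*} [Fintype ι] {K : Set F} {h : ι → F → ℝ}
    (hh : ∀ i, ConcaveOn ℝ K (h i)) {y y' w y₀ : F} (hy : y ∈ K) (hy' : y' ∈ K) (hw : w ∈ K)
    (hy₀ : y₀ ∈ K) {t R L : ℝ} (ht0 : 0 ≤ t) (ht1 : t ≤ 1)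
    (hcross : (1 - t) • y + t • w = (1 - t) • y' + t • y₀)
    (hsum : ∀ v ∈ K, |∑ i, h i v - ∑ i, h i y'| ≤ L * ‖v - y'‖)
    (hR : ∀ i, h i y - h i w ≤ R) (hR' : ∀ i, h i y' - h i y₀ ≤ R) (i : ι) :
    h i y - h i y' ≤ t * (Fintype.card ι * R + L * ‖y₀ - y'‖) := by
  set v := (1 - t) • y' + t • y₀ with hv
  have hvK : v ∈ K := (hh i).1 hy' hy₀ (sub_nonneg.2 ht1) ht0 (sub_add_cancel 1 t)
  have hfrom_y : h i y - h i v ≤ t * R := by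
    rw [← hcross]
    exact sub_le_mul_of_concaveOn (hh i) hy hw ht0 ht1 (hR i)
  have hfrom_y' : ∀ l, 0 ≤ t * R - (h l y' - h l v) := fun l =>
    sub_nonneg.2 (sub_le_mul_of_concaveOn (hh l) hy' hy₀ ht0 ht1 (hR' l))
  have hvy' : ‖v - y'‖ = t * ‖y₀ - y'‖ := by
    rw [show v - y' = t • (y₀ - y') by rw [hv, sub_smul, one_smul, smul_sub]; abel, norm_smul,
      Real.norm_of_nonneg ht0]
  have hsumv : ∑ l, h l v - ∑ l, h l y' ≤ L * (t * ‖y₀ - y'‖) := by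
    rw [← hvy']
    exact (le_abs_self _).trans (hsum v hvK)
  have hsingle := Finset.single_le_sum (fun l _ => hfrom_y' l) (Finset.mem_univ i)
  simp only [Finset.sum_sub_distrib, Finset.sum_const, Finset.card_univ, nsmul_eq_mul] at hsingle
  linarith

theorem exists_sub_le_of_concaveOn [FiniteDimensional ℝ F] {φ : F → ℝ}
    (hφ : ConcaveOn ℝ Set.univ φ) (y₀ : F) (r : ℝ) :
    ∃ M, 0 ≤ M ∧ ∀ y w, ‖w - y₀‖ ≤ r → φ y - φ w ≤ M * (1 + ‖y - y₀‖) := by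
  have : ProperSpace F := FiniteDimensional.proper ℝ F
  have hcont : Continuous φ := hφ.locallyLipschitz.continuous
  obtain ⟨C, hC⟩ := (isCompact_closedBall y₀ r).exists_bound_of_continuousOn
    (f := fun w => φ y₀ - φ w) (by fun_prop)
  obtain ⟨ℓ, hℓ⟩ := exists_strongDual_add_le_of_convexOn hφ.neg hcont.neg y₀
  refine ⟨|C| + ‖ℓ‖, by positivity, fun y w hw => ?_⟩
  have hnear : φ y₀ - φ w ≤ |C| :=
    (le_abs_self _).trans ((hC w (mem_closedBall_iff_norm.2 hw)).trans (le_abs_self C))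
  have hfar : φ y - φ y₀ ≤ ‖ℓ‖ * ‖y - y₀‖ := by
    have hle := (neg_le_abs _).trans (ℓ.le_opNorm (y - y₀))
    have := hℓ y
    simp only [Pi.neg_apply] at this
    linarith
  linarith [mul_nonneg (abs_nonneg C) (norm_nonneg (y - y₀)), norm_nonneg ℓ]

theorem exists_sub_le_of_concaveOn_of_lipschitz [FiniteDimensional ℝ F] {ι : Type*} [Finite ι]
    {X : Set E} (hX : X.Nonempty) {Y : Set F} {f : ι → E → F → ℝ}
    (hf : ∀ i x, ConcaveOn ℝ Set.univ (f i x)) {L : ℝ} (hL : 0 ≤ L)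
    (hfx : ∀ i, ∀ x ∈ X, ∀ x' ∈ X, ∀ y ∈ Y, |f i x y - f i x' y| ≤ L * ‖x - x'‖) (y₀ : F) (r : ℝ) :
    ∃ C, 0 ≤ C ∧ ∀ i, ∀ x ∈ X, ∀ y ∈ Y, ∀ w ∈ Y, ‖w - y₀‖ ≤ r →
      f i x y - f i x w ≤ C * (1 + ‖x‖ + ‖y‖) := by
  obtain ⟨x₀, hx₀⟩ := hX
  cases nonempty_fintype ι
  choose M hM0 hM using fun i => exists_sub_le_of_concaveOn (hf i x₀) y₀ r
  set B := ∑ i, M i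
  have hB : 0 ≤ B := Finset.sum_nonneg fun i _ => hM0 i
  refine ⟨2 * L * (1 + ‖x₀‖) + B * (1 + ‖y₀‖), by positivity, fun i x hx y hy w hw hwr => ?_⟩
  have hMB : M i ≤ B := Finset.single_le_sum (fun i _ => hM0 i) (Finset.mem_univ i)
  have hx_norm : ‖x - x₀‖ ≤ (1 + ‖x₀‖) * (1 + ‖x‖ + ‖y‖) := by
    nlinarith [norm_sub_le x x₀, norm_nonneg x, norm_nonneg y, norm_nonneg x₀]
  have hy_norm : 1 + ‖y - y₀‖ ≤ (1 + ‖y₀‖) * (1 + ‖x‖ + ‖y‖) := by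
    nlinarith [norm_sub_le y y₀, norm_nonneg x, norm_nonneg y, norm_nonneg y₀]
  calc f i x y - f i x w
      = (f i x y - f i x₀ y) + (f i x₀ y - f i x₀ w) + (f i x₀ w - f i x w) := by ring
    _ ≤ L * ‖x - x₀‖ + M i * (1 + ‖y - y₀‖) + L * ‖x - x₀‖ := by
        gcongr
        · exact (le_abs_self _).trans (hfx i x hx x₀ hx₀ y hy)
        · exact hM i y w hwr
        · rw [norm_sub_rev]
          exact (le_abs_self _).trans (hfx i x₀ hx₀ x hx w hw)
    _ = 2 * L * ‖x - x₀‖ + M i * (1 + ‖y - y₀‖) := by ring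
    _ ≤ 2 * L * ((1 + ‖x₀‖) * (1 + ‖x‖ + ‖y‖)) + B * ((1 + ‖y₀‖) * (1 + ‖x‖ + ‖y‖)) := by
        gcongr
    _ = _ := by ring

theorem exists_lipschitz_linear_growth [FiniteDimensional ℝ F] {ι : Type*} [Fintype ι]
    {X : Set E} {Y : Set F} (hX : X.Nonempty) (hY : Y.Nonempty) (hYconv : Convex ℝ Y)
    {f : ι → E → F → ℝ} (hf : ∀ i x, ConcaveOn ℝ Set.univ (f i x)) {L L' : ℝ} (hL : 0 ≤ L)
    (hL' : 0 ≤ L') (hfx : ∀ i, ∀ x ∈ X, ∀ x' ∈ X, ∀ y ∈ Y, |f i x y - f i x' y| ≤ L * ‖x - x'‖)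
    (hsum : ∀ x ∈ X, ∀ y ∈ Y, ∀ y' ∈ Y, |∑ i, f i x y - ∑ i, f i x y'| ≤ L' * ‖y - y'‖) :
    ∃ C, 0 ≤ C ∧ ∀ i, ∀ x ∈ X, ∀ y ∈ Y, ∀ y' ∈ Y,
      |f i x y - f i x y'| ≤ C * (1 + ‖x‖ + ‖y‖ + ‖y'‖) * ‖y - y'‖ := by
  obtain ⟨y₀, hy₀, r, hr, hcross⟩ := exists_crossing_segments hYconv hY
  obtain ⟨C₁, hC₁, hosc⟩ := exists_sub_le_of_concaveOn_of_lipschitz hX hf hL hfx y₀ r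
  set C := (Fintype.card ι * C₁ + L' * (1 + ‖y₀‖)) / r
  have hle : ∀ i, ∀ x ∈ X, ∀ y ∈ Y, ∀ y' ∈ Y,
      f i x y - f i x y' ≤ C * (1 + ‖x‖ + ‖y‖ + ‖y'‖) * ‖y - y'‖ := by
    intro i x hx y hy y' hy'
    set S := 1 + ‖x‖ + ‖y‖ + ‖y'‖
    obtain ⟨t, ht0, ht1, htr, w, hw, hwr, hmeet⟩ := hcross y hy y' hy'
    have hR : ∀ l, f l x y - f l x w ≤ C₁ * S := fun l =>
      (hosc l x hx y hy w hw hwr).trans (by gcongr; linarith [norm_nonneg y'])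
    have hR' : ∀ l, f l x y' - f l x y₀ ≤ C₁ * S := fun l =>
      (hosc l x hx y' hy' y₀ hy₀ (by simpa using hr.le)).trans
        (by gcongr; linarith [norm_nonneg y])
    have hy₀y' : ‖y₀ - y'‖ ≤ (1 + ‖y₀‖) * S := by
      nlinarith [norm_sub_le y₀ y', norm_nonneg x, norm_nonneg y, norm_nonneg y', norm_nonneg y₀]
    calc f i x y - f i x y' ≤ t * (Fintype.card ι * (C₁ * S) + L' * ‖y₀ - y'‖) :=
          sub_le_of_concaveOn_of_sum_lipschitz
            (fun l => (hf l x).subset (Set.subset_univ Y) hYconv) hy hy' hw hy₀ ht0 ht1 hmeet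
            (fun v hv => hsum x hx v hv y' hy') hR hR' i
      _ ≤ ‖y - y'‖ / r * (Fintype.card ι * (C₁ * S) + L' * ((1 + ‖y₀‖) * S)) := by gcongr
      _ = C * S * ‖y - y'‖ := by ring
  refine ⟨C, by positivity, fun i x hx y hy y' hy' => abs_sub_le_iff.2 ⟨hle i x hx y hy y' hy', ?_⟩⟩
  rw [norm_sub_rev, add_right_comm]
  exact hle i x hx y' hy' y hy

variable [NormedSpace ℝ E] [ProperSpace E] {X : Set E} {φ : E → ℝ} {xs : E} {δ : ℝ}

theorem exists_pos_le_sub_on_sphere (hX : IsClosed X) (hcont : ContinuousOn φ X)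
    (hφ : StrictConvexOn ℝ X φ) (hxs : xs ∈ X) (hmin : IsMinOn φ X xs) (hδ : 0 < δ) :
    ∃ μ > 0, ∀ x ∈ X ∩ Metric.sphere xs δ, μ ≤ φ x - φ xs := by
  rcases (X ∩ Metric.sphere xs δ).eq_empty_or_nonempty with hempty | hne
  · exact ⟨1, one_pos, by simp [hempty]⟩
  obtain ⟨x, ⟨hxX, hxδ⟩, hxmin⟩ := ((isCompact_sphere xs δ).inter_left hX).exists_isMinOn hne
    (hcont.mono Set.inter_subset_left)
  have hlt : φ xs < φ x := by
    refine (hmin hxX).lt_of_ne fun heq => hδ.ne ?_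
    have hxmin' : IsMinOn φ X x := fun z hz => heq.symm.le.trans (hmin hz)
    rw [← mem_sphere_iff_norm.1 hxδ, hφ.eq_of_isMinOn hxmin' hmin hxX hxs, sub_self, norm_zero]
  exact ⟨φ x - φ xs, sub_pos.2 hlt, fun y hy => sub_le_sub_right (hxmin hy) _⟩

theorem exists_linear_growth_of_strictConvexOn (hX : IsClosed X) (hcont : ContinuousOn φ X)
    (hφ : StrictConvexOn ℝ X φ) (hxs : xs ∈ X) (hmin : IsMinOn φ X xs) (hδ : 0 < δ) :
    ∃ c > 0, ∀ x ∈ X, δ ≤ ‖x - xs‖ → c * ‖x - xs‖ ≤ φ x - φ xs := by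
  obtain ⟨μ, hμ, hsphere⟩ := exists_pos_le_sub_on_sphere hX hcont hφ hxs hmin hδ
  refine ⟨μ / δ, div_pos hμ hδ, fun x hx hxδ => ?_⟩
  have hd : 0 < ‖x - xs‖ := hδ.trans_le hxδ
  set t := δ / ‖x - xs‖ with ht
  have ht0 : 0 ≤ t := by positivity
  have ht1 : 0 ≤ 1 - t := sub_nonneg.2 ((div_le_one hd).2 hxδ)
  have hmem : (1 - t) • xs + t • x ∈ X ∩ Metric.sphere xs δ := by
    refine ⟨hφ.1 hxs hx ht1 ht0 (sub_add_cancel 1 t), ?_⟩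
    have hsub : (1 - t) • xs + t • x - xs = t • (x - xs) := by
      rw [sub_smul, one_smul, smul_sub]
      abel
    rw [mem_sphere_iff_norm, hsub, norm_smul, Real.norm_of_nonneg ht0, ht,
      div_mul_cancel₀ _ hd.ne']
  have hscaled : μ ≤ t * (φ x - φ xs) := by
    have hconvex := hφ.convexOn.2 hxs hx ht1 ht0 (sub_add_cancel 1 t)
    rw [smul_eq_mul, smul_eq_mul] at hconvex
    linarith [hsphere _ hmem]
  calc μ / δ * ‖x - xs‖ ≤ t * (φ x - φ xs) / δ * ‖x - xs‖ := by gcongr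
    _ = φ x - φ xs := by rw [ht]; field_simp

end Growth

/-! ### Weighted averages -/

section Averages

variable {ι E : Type*} [Fintype ι] [NormedAddCommGroup E]

/-- The weighted squared distance of the states `x i` from `z`. With the Perron vectors as weights
it is the Lyapunov function of a subnetwork. -/
def weightedSqDist (w : ι → ℝ) (x : ι → E) (z : E) : ℝ :=
  ∑ i, w i * ‖x i - z‖ ^ 2

theorem weightedSqDist_nonneg {w : ι → ℝ} (hw : ∀ i, 0 ≤ w i) (x : ι → E) (z : E) :
    0 ≤ weightedSqDist w x z :=
  Finset.sum_nonneg fun i _ => mul_nonneg (hw i) (sq_nonneg _)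

theorem weightedSqDist_le_sq {w : ι → ℝ} (hw : w ∈ stdSimplex ℝ ι) (x : ι → E) (z : E) (i₀ : ι) :
    weightedSqDist w x z ≤ (‖x i₀ - z‖ + ∑ i, ‖x i - x i₀‖) ^ 2 := by
  calc weightedSqDist w x z ≤ ∑ i, w i * (‖x i₀ - z‖ + ∑ i, ‖x i - x i₀‖) ^ 2 := by
        refine Finset.sum_le_sum fun i _ => mul_le_mul_of_nonneg_left ?_ (hw.1 i)
        have hsingle : ‖x i - x i₀‖ ≤ ∑ i, ‖x i - x i₀‖ := Finset.single_le_sum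
          (f := fun i => ‖x i - x i₀‖) (fun i _ => norm_nonneg _) (Finset.mem_univ i)
        gcongr
        linarith [norm_sub_le_norm_sub_add_norm_sub (x i) (x i₀) z]
    _ = _ := by rw [← Finset.sum_mul, hw.2, one_mul]

theorem mul_sq_le_weightedSqDist {w : ι → ℝ} {c : ℝ} (hc : 0 ≤ c) (hw : ∀ i, c ≤ w i) (x : ι → E)
    (z : E) (i₀ : ι) : c * ‖x i₀ - z‖ ^ 2 ≤ weightedSqDist w x z :=
  (mul_le_mul_of_nonneg_right (hw i₀) (sq_nonneg _)).trans
    (Finset.single_le_sum (f := fun i => w i * ‖x i - z‖ ^ 2)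
      (fun i _ => mul_nonneg (hc.trans (hw i)) (sq_nonneg _)) (Finset.mem_univ i₀))

variable [NormedSpace ℝ E]

theorem weightedSqDist_average_le {A : Matrix ι ι ℝ} [DecidableEq ι]
    (hA : A ∈ Matrix.rowStochastic ℝ ι) {w : ι → ℝ} (hw : ∀ i, 0 ≤ w i) (x : ι → E) (z : E) :
    weightedSqDist w (fun i => ∑ j, A i j • x j) z ≤ weightedSqDist (Matrix.vecMul w A) x z := by
  have hconvex : ConvexOn ℝ Set.univ ((fun u => dist u z) ^ 2 : E → ℝ) :=
    (convexOn_univ_dist z).pow (fun _ _ => dist_nonneg) 2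
  have hjensen : ∀ i, ‖∑ j, A i j • x j - z‖ ^ 2 ≤ ∑ j, A i j * ‖x j - z‖ ^ 2 := fun i => by
    simpa [dist_eq_norm] using hconvex.map_sum_le (fun j _ => hA.1 i j)
      (Matrix.sum_row_of_mem_rowStochastic hA i) (fun j _ => Set.mem_univ (x j))
  calc weightedSqDist w (fun i => ∑ j, A i j • x j) z
      ≤ ∑ i, w i * ∑ j, A i j * ‖x j - z‖ ^ 2 :=
        Finset.sum_le_sum fun i _ => mul_le_mul_of_nonneg_left (hjensen i) (hw i)
    _ = weightedSqDist (Matrix.vecMul w A) x z := by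
        simp only [weightedSqDist, Matrix.vecMul, dotProduct, Finset.mul_sum, Finset.sum_mul]
        rw [Finset.sum_comm]
        simp only [mul_assoc]

theorem tendsto_sum_smul_sub {w : ℕ → ι → ℝ} (hw : ∀ k, w k ∈ stdSimplex ℝ ι) {x : ℕ → ι → E}
    {z : ℕ → E} (hx : ∀ i, Tendsto (fun k => x k i - z k) atTop (𝓝 0)) :
    Tendsto (fun k => ∑ i, w k i • x k i - z k) atTop (𝓝 0) := by
  refine squeeze_zero_norm (a := fun k => ∑ i, ‖x k i - z k‖) (fun k => ?_) ?_
  · rw [← mem_closedBall_iff_norm]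
    refine (convex_closedBall _ _).sum_mem (fun i _ => (hw k).1 i) (hw k).2 fun i _ => ?_
    rw [mem_closedBall_iff_norm]
    exact Finset.single_le_sum (f := fun i => ‖x k i - z k‖) (fun i _ => norm_nonneg _)
      (Finset.mem_univ i)
  · simpa using tendsto_finsetSum Finset.univ fun i _ => (hx i).norm

end Averages

/-! ### The dynamics of one subnetwork -/

theorem sub_sub_mul_le_of_perturbation {E F : Type*} [NormedAddCommGroup E] [NormedAddCommGroup F]
    {X : Set E} {Y : Set F} {f : E → F → ℝ} {L C : ℝ} (hL : 0 ≤ L) (hC : 0 ≤ C)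
    (hfx : ∀ x ∈ X, ∀ x' ∈ X, ∀ y ∈ Y, |f x y - f x' y| ≤ L * ‖x - x'‖)
    (hfy : ∀ x ∈ X, ∀ y ∈ Y, ∀ y' ∈ Y,
      |f x y - f x y'| ≤ C * (1 + ‖x‖ + ‖y‖ + ‖y'‖) * ‖y - y'‖)
    {u u' z : E} (hu : u ∈ X) (hu' : u' ∈ X) (hz : z ∈ X) {v v' : F} (hv : v ∈ Y) (hv' : v' ∈ Y)
    (hvv' : ‖v' - v‖ ≤ 1) :
    f u v - f z v - (L * ‖u' - u‖ + C * (4 + ‖z‖) * ‖v' - v‖) * (1 + ‖u‖ + ‖v‖) ≤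
      f u' v' - f z v' := by
  set S := 1 + ‖u‖ + ‖v‖
  have hS : 1 ≤ S := by linarith [norm_nonneg u, norm_nonneg v]
  have hv'_norm : ‖v'‖ ≤ 1 + ‖v‖ := by linarith [norm_sub_norm_le v' v]
  have hmove_u : f u v' - f u' v' ≤ L * ‖u' - u‖ * S := by
    rw [norm_sub_rev]
    exact ((le_abs_self _).trans (hfx u hu u' hu' v' hv')).trans
      (le_mul_of_one_le_right (by positivity) hS)
  have hmove_v : f u v - f u v' ≤ C * (2 * S) * ‖v' - v‖ := by
    refine ((le_abs_self _).trans (hfy u hu v hv v' hv')).trans ?_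
    rw [norm_sub_rev]
    gcongr
    linarith [norm_nonneg u]
  have hmove_v_at_z : f z v' - f z v ≤ C * ((2 + ‖z‖) * S) * ‖v' - v‖ := by
    refine ((le_abs_self _).trans (hfy z hz v' hv' v hv)).trans ?_
    gcongr
    linarith [norm_nonneg u, le_mul_of_one_le_right (norm_nonneg z) hS]
  linarith

/-- The projected subgradient dynamics of one subnetwork, together with the standing assumptions on
it. The stepsizes are `γ k / est k i`, where `est` learns the Perron vectors `φ`, and `xb k i` is
the information of agent `i` on the other subnetwork. -/
structure IsSubgradientDynamics {n m₁ m₂ : ℕ} (X : Set (Euc m₁)) (Y : Set (Euc m₂))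
    (f : Fin n → Euc m₁ → Euc m₂ → ℝ) (A : ℕ → Matrix (Fin n) (Fin n) ℝ)
    (φ est : ℕ → Fin n → ℝ) (γ : ℕ → ℝ) (L : ℝ) (x : ℕ → Fin n → Euc m₁)
    (xb : ℕ → Fin n → Euc m₂) (q : ℕ → Fin n → Euc m₁) : Prop where
  weights : ConsensusWeights A
  convex_X : Convex ℝ X
  convex_f : ∀ i y, ConvexOn ℝ Set.univ fun x => f i x y
  perron : ∀ s, IsPerronLimit A s (φ s)
  est_pos : ∀ k i, 0 < est k i
  est_lim : ∀ i, Tendsto (fun k => est k i - φ (k + 1) i) atTop (𝓝 0)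
  step_nonneg : ∀ k, 0 ≤ γ k
  step_lim : Tendsto γ atTop (𝓝 0)
  L_nonneg : 0 ≤ L
  bound : ∀ i, ∀ x ∈ X, ∀ y ∈ Y, ∀ q ∈ convexSubdiff (fun x' => f i x' y) x, ‖q‖ ≤ L
  mem_Y : ∀ᶠ k in atTop, ∀ i, xb k i ∈ Y
  subgrad : ∀ k i, q k i ∈ convexSubdiff (fun x' => f i x' (xb k i)) (∑ j, A k i j • x k j)
  proj : ∀ k i, IsProjection X (∑ j, A k i j • x k j - (1 / est k i * γ k) • q k i) (x (k + 1) i)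

namespace IsSubgradientDynamics

variable {n m₁ m₂ : ℕ} {X : Set (Euc m₁)} {Y : Set (Euc m₂)}
  {f : Fin n → Euc m₁ → Euc m₂ → ℝ} {A : ℕ → Matrix (Fin n) (Fin n) ℝ}
  {φ est : ℕ → Fin n → ℝ} {γ : ℕ → ℝ} {L : ℝ} {x : ℕ → Fin n → Euc m₁}
  {xb : ℕ → Fin n → Euc m₂} {q : ℕ → Fin n → Euc m₁}

theorem perron_mem_stdSimplex [Nonempty (Fin n)]
    (D : IsSubgradientDynamics X Y f A φ est γ L x xb q) (k : ℕ) : φ k ∈ stdSimplex ℝ (Fin n) :=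
  (D.perron k).mem_stdSimplex D.weights.stochastic

theorem exists_inv_est_le (D : IsSubgradientDynamics X Y f A φ est γ L x xb q) :
    ∃ c > 0, ∀ᶠ k in atTop, ∀ i, 1 / est k i ≤ c := by
  obtain ⟨c, hc, hφ⟩ := D.weights.exists_perron_lower
  refine ⟨1 / (c / 2), by positivity, eventually_all.2 fun i => ?_⟩
  filter_upwards [(D.est_lim i).eventually (lt_mem_nhds (neg_neg_of_pos (half_pos hc)))] with k hk
  exact one_div_le_one_div_of_le (by positivity) (by linarith [hφ _ _ (D.perron (k + 1)) i])

theorem tendsto_perron_div_est (D : IsSubgradientDynamics X Y f A φ est γ L x xb q) (i : Fin n) :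
    Tendsto (fun k => φ (k + 1) i * (1 / est k i) - 1) atTop (𝓝 0) := by
  obtain ⟨c, -, hle⟩ := D.exists_inv_est_le
  refine squeeze_zero_norm' (a := fun k => |est k i - φ (k + 1) i| * c) ?_ ?_
  · filter_upwards [hle] with k hk
    have hpos := D.est_pos k i
    have hfactor : φ (k + 1) i * (1 / est k i) - 1 =
        -(est k i - φ (k + 1) i) * (1 / est k i) := by
      field_simp
      ring
    rw [hfactor, Real.norm_eq_abs, abs_mul, abs_neg, abs_of_pos (one_div_pos.2 hpos)]
    exact mul_le_mul_of_nonneg_left (hk i) (abs_nonneg _)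
  · simpa using (D.est_lim i).abs.mul_const c

theorem mem_X (D : IsSubgradientDynamics X Y f A φ est γ L x xb q) {k : ℕ} (hk : 1 ≤ k)
    (i : Fin n) : x k i ∈ X := by
  obtain ⟨k, rfl⟩ := Nat.exists_eq_add_of_le' hk
  exact (D.proj k i).1

theorem average_mem (D : IsSubgradientDynamics X Y f A φ est γ L x xb q) {k : ℕ} (hk : 1 ≤ k)
    (i : Fin n) : ∑ j, A k i j • x k j ∈ X :=
  D.convex_X.sum_mem (fun j _ => D.weights.nonneg k i j)
    (Matrix.sum_row_of_mem_rowStochastic (D.weights.stochastic k) i) fun j _ => D.mem_X hk j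

theorem eventually_norm_subgrad_le (D : IsSubgradientDynamics X Y f A φ est γ L x xb q) :
    ∀ᶠ k in atTop, ∀ i, ‖q k i‖ ≤ L := by
  filter_upwards [D.mem_Y, eventually_ge_atTop 1] with k hY hk i
  exact D.bound i _ (D.average_mem hk i) _ (hY i) _ (D.subgrad k i)

theorem tendsto_disturbance (D : IsSubgradientDynamics X Y f A φ est γ L x xb q) (i : Fin n) :
    Tendsto (fun k => x (k + 1) i - ∑ j, A k i j • x k j) atTop (𝓝 0) := by
  obtain ⟨c, hc, hinv⟩ := D.exists_inv_est_le
  refine squeeze_zero_norm' (a := fun k => c * γ k * L) ?_ ?_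
  · filter_upwards [hinv, D.eventually_norm_subgrad_le, eventually_ge_atTop 1] with k hinv hq hk
    have hγ := D.step_nonneg k
    have hstep : 0 ≤ 1 / est k i * γ k := mul_nonneg (one_div_nonneg.2 (D.est_pos k i).le) hγ
    calc ‖x (k + 1) i - ∑ j, A k i j • x k j‖ ≤ ‖(1 / est k i * γ k) • q k i‖ := by
          simpa using (D.proj k i).norm_sub_le D.convex_X (D.average_mem hk i)
      _ = 1 / est k i * γ k * ‖q k i‖ := by rw [norm_smul, Real.norm_of_nonneg hstep]
      _ ≤ c * γ k * L := by
          gcongr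
          exacts [hinv i, hq i]
  · simpa using (D.step_lim.const_mul c).mul_const L

theorem tendsto_sub (D : IsSubgradientDynamics X Y f A φ est γ L x xb q) (i j : Fin n) :
    Tendsto (fun k => x k i - x k j) atTop (𝓝 0) :=
  D.weights.tendsto_sub (e := fun k i => x (k + 1) i - ∑ j, A k i j • x k j)
    (fun _ _ => (add_sub_cancel _ _).symm) D.tendsto_disturbance i j

theorem tendsto_average_sub (D : IsSubgradientDynamics X Y f A φ est γ L x xb q) (i j : Fin n) :
    Tendsto (fun k => ∑ l, A k i l • x k l - x k j) atTop (𝓝 0) :=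
  tendsto_sum_smul_sub (w := fun k => A k i) (fun k => ⟨D.weights.nonneg k i,
    Matrix.sum_row_of_mem_rowStochastic (D.weights.stochastic k) i⟩) fun l => D.tendsto_sub l j

theorem tendsto_add_sub (D : IsSubgradientDynamics X Y f A φ est γ L x xb q) (d : ℕ)
    (i j : Fin n) : Tendsto (fun k => x (k + d) i - x k j) atTop (𝓝 0) := by
  induction d generalizing i with
  | zero => exact D.tendsto_sub i j
  | succ d ih =>
    have hnext : Tendsto (fun k => x (k + 1) i - x k i) atTop (𝓝 0) := by
      simpa using (D.tendsto_disturbance i).add (D.tendsto_average_sub i i)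
    simpa [add_assoc] using ((tendsto_add_atTop_iff_nat d).2 hnext).add (ih i)

theorem abs_sub_le (D : IsSubgradientDynamics X Y f A φ est γ L x xb q) (i : Fin n) {y : Euc m₂}
    (hy : y ∈ Y) {u u' : Euc m₁} (hu : u ∈ X) (hu' : u' ∈ X) :
    |f i u y - f i u' y| ≤ L * ‖u - u'‖ :=
  abs_sub_le_of_subgradients_bounded (D.convex_f i y) (fun x hx => D.bound i x hx y hy) hu hu'

theorem weightedSqDist_average_le (D : IsSubgradientDynamics X Y f A φ est γ L x xb q)
    [Nonempty (Fin n)] (k : ℕ) (z : Euc m₁) :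
    weightedSqDist (φ (k + 1)) (fun i => ∑ j, A k i j • x k j) z ≤
      weightedSqDist (φ k) (x k) z := by
  rw [(D.perron k).eq_vecMul (D.perron (k + 1))]
  exact _root_.weightedSqDist_average_le (D.weights.stochastic k)
    (D.perron_mem_stdSimplex (k + 1)).1 (x k) z

theorem perron_mul_norm_sub_sq_le (D : IsSubgradientDynamics X Y f A φ est γ L x xb q)
    {c : ℝ} {z : Euc m₁} (hz : z ∈ X) {k : ℕ} (hk : 1 ≤ k) {i : Fin n} (hY : xb k i ∈ Y)
    (hinv : 1 / est k i ≤ c) :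
    φ (k + 1) i * ‖x (k + 1) i - z‖ ^ 2 ≤
      φ (k + 1) i * ‖∑ j, A k i j • x k j - z‖ ^ 2 -
        2 * γ k * (φ (k + 1) i * (1 / est k i) *
          (f i (∑ j, A k i j • x k j) (xb k i) - f i z (xb k i))) + (γ k * (c * L)) ^ 2 := by
  have : Nonempty (Fin n) := ⟨i⟩
  obtain ⟨hφ0, hφ1⟩ := mem_Icc_of_mem_stdSimplex (D.perron_mem_stdSimplex (k + 1)) i
  have hγ := D.step_nonneg k
  have hinv0 : 0 ≤ 1 / est k i := one_div_nonneg.2 (D.est_pos k i).le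
  have hstep0 : 0 ≤ 1 / est k i * γ k := mul_nonneg hinv0 hγ
  have hq : ‖q k i‖ ≤ L := D.bound i _ (D.average_mem hk i) _ hY _ (D.subgrad k i)
  have hquad : φ (k + 1) i * ((1 / est k i * γ k) ^ 2 * ‖q k i‖ ^ 2) ≤ (γ k * (c * L)) ^ 2 := by
    calc φ (k + 1) i * ((1 / est k i * γ k) ^ 2 * ‖q k i‖ ^ 2)
        ≤ 1 * ((c * γ k) ^ 2 * L ^ 2) := by gcongr
      _ = (γ k * (c * L)) ^ 2 := by ring
  have hstep := mul_le_mul_of_nonneg_left (norm_sub_sq_le_of_subgradient_step D.convex_X hstep0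
    (D.subgrad k i) (D.proj k i) hz) hφ0
  linarith

theorem agent_drift_le (D : IsSubgradientDynamics X Y f A φ est γ L x xb q)
    {c C : ℝ} (hC : 0 ≤ C)
    (hfy : ∀ i, ∀ x ∈ X, ∀ y ∈ Y, ∀ y' ∈ Y,
      |f i x y - f i x y'| ≤ C * (1 + ‖x‖ + ‖y‖ + ‖y'‖) * ‖y - y'‖)
    {z u : Euc m₁} {v : Euc m₂} (hz : z ∈ X) (hu : u ∈ X) (hv : v ∈ Y) {k : ℕ} (hk : 1 ≤ k)
    {i : Fin n} (hY : xb k i ∈ Y) (hinv : 1 / est k i ≤ c)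
    (hxu : ‖∑ j, A k i j • x k j - u‖ ≤ 1) (hbv : ‖xb k i - v‖ ≤ 1) :
    φ (k + 1) i * ‖x (k + 1) i - z‖ ^ 2 ≤
      φ (k + 1) i * ‖∑ j, A k i j • x k j - z‖ ^ 2 - 2 * γ k * (f i u v - f i z v -
        (|φ (k + 1) i * (1 / est k i) - 1| * (L * (2 + ‖z‖)) +
          L * ‖∑ j, A k i j • x k j - u‖ + C * (4 + ‖z‖) * ‖xb k i - v‖ +
          γ k * (c * L) ^ 2) * (1 + ‖u‖ + ‖v‖)) := by
  have hstep := D.perron_mul_norm_sub_sq_le hz hk hY hinv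
  have hX := D.average_mem hk i
  set xh := ∑ j, A k i j • x k j
  set ω := φ (k + 1) i * (1 / est k i)
  set S := 1 + ‖u‖ + ‖v‖
  have hS : 1 ≤ S := by linarith [norm_nonneg u, norm_nonneg v]
  have hγ := D.step_nonneg k
  have hL := D.L_nonneg
  set gap := f i xh (xb k i) - f i z (xb k i)
  have hxh_norm : ‖xh - z‖ ≤ (2 + ‖z‖) * S := by
    linarith [norm_sub_le_norm_sub_add_norm_sub xh u z, norm_sub_le u z, norm_nonneg v,
      le_mul_of_one_le_right (norm_nonneg z) hS]
  have hgap_abs : |gap| ≤ L * ((2 + ‖z‖) * S) :=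
    (D.abs_sub_le i hY hX hz).trans (mul_le_mul_of_nonneg_left hxh_norm hL)
  have hweight : gap - |ω - 1| * (L * ((2 + ‖z‖) * S)) ≤ ω * gap := by
    have hle := neg_abs_le ((ω - 1) * gap)
    rw [abs_mul] at hle
    linarith [mul_le_mul_of_nonneg_left hgap_abs (abs_nonneg (ω - 1))]
  have hgap : f i u v - f i z v - (L * ‖xh - u‖ + C * (4 + ‖z‖) * ‖xb k i - v‖) * S ≤ gap :=
    sub_sub_mul_le_of_perturbation hL hC (fun x hx x' hx' y hy => D.abs_sub_le i hy hx hx') (hfy i)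
      hu hX hz hv hY hbv
  have hquad : (γ k * (c * L)) ^ 2 ≤ 2 * γ k * (γ k * (c * L) ^ 2 * S) := by
    have : 0 ≤ γ k ^ 2 * (c * L) ^ 2 := by positivity
    nlinarith
  have hmul := mul_le_mul_of_nonneg_left (hgap.trans (sub_le_iff_le_add.1 hweight))
    (mul_nonneg zero_le_two hγ)
  linarith

theorem exists_agent_drift (D : IsSubgradientDynamics X Y f A φ est γ L x xb q)
    {C : ℝ} (hC : 0 ≤ C)
    (hfy : ∀ i, ∀ x ∈ X, ∀ y ∈ Y, ∀ y' ∈ Y,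
      |f i x y - f i x y'| ≤ C * (1 + ‖x‖ + ‖y‖ + ‖y'‖) * ‖y - y'‖)
    {z : Euc m₁} (hz : z ∈ X) (i₀ : Fin n) {v : ℕ → Euc m₂} (hv : ∀ᶠ k in atTop, v k ∈ Y)
    (hbv : ∀ i, Tendsto (fun k => xb k i - v k) atTop (𝓝 0)) (i : Fin n) :
    ∃ ε : ℕ → ℝ, Tendsto ε atTop (𝓝 0) ∧ ∀ᶠ k in atTop,
      φ (k + 1) i * ‖x (k + 1) i - z‖ ^ 2 ≤ φ (k + 1) i * ‖∑ j, A k i j • x k j - z‖ ^ 2 -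
        2 * γ k * (f i (x k i₀) (v k) - f i z (v k) - ε k * (1 + ‖x k i₀‖ + ‖v k‖)) := by
  obtain ⟨c, -, hinv⟩ := D.exists_inv_est_le
  have hxlim := (D.tendsto_average_sub i i₀).norm
  have hblim := (hbv i).norm
  rw [norm_zero] at hxlim hblim
  refine ⟨fun k => |φ (k + 1) i * (1 / est k i) - 1| * (L * (2 + ‖z‖)) +
    L * ‖∑ j, A k i j • x k j - x k i₀‖ + C * (4 + ‖z‖) * ‖xb k i - v k‖ +
    γ k * (c * L) ^ 2, ?_, ?_⟩
  · simpa using ((((D.tendsto_perron_div_est i).abs.mul_const (L * (2 + ‖z‖))).add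
      (hxlim.const_mul L)).add (hblim.const_mul (C * (4 + ‖z‖)))).add
      (D.step_lim.mul_const ((c * L) ^ 2))
  · filter_upwards [hxlim.eventually_le_const one_pos, hblim.eventually_le_const one_pos, hv, hinv,
      D.mem_Y, eventually_ge_atTop 1] with k hxu hbv hv hinv hY hk
    exact D.agent_drift_le hC hfy hz (D.mem_X hk i₀) hv hk (hY i) (hinv i) hxu hbv

theorem exists_drift (D : IsSubgradientDynamics X Y f A φ est γ L x xb q)
    {C : ℝ} (hC : 0 ≤ C)
    (hfy : ∀ i, ∀ x ∈ X, ∀ y ∈ Y, ∀ y' ∈ Y,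
      |f i x y - f i x y'| ≤ C * (1 + ‖x‖ + ‖y‖ + ‖y'‖) * ‖y - y'‖)
    {z : Euc m₁} (hz : z ∈ X) (i₀ : Fin n) {v : ℕ → Euc m₂} (hv : ∀ᶠ k in atTop, v k ∈ Y)
    (hbv : ∀ i, Tendsto (fun k => xb k i - v k) atTop (𝓝 0)) :
    ∃ ε : ℕ → ℝ, Tendsto ε atTop (𝓝 0) ∧ ∀ᶠ k in atTop,
      weightedSqDist (φ (k + 1)) (x (k + 1)) z ≤ weightedSqDist (φ k) (x k) z -
        2 * γ k * (sumObjective f (x k i₀) (v k) - sumObjective f z (v k) -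
          ε k * (1 + ‖x k i₀‖ + ‖v k‖)) := by
  have : Nonempty (Fin n) := ⟨i₀⟩
  choose ε hε hagent using D.exists_agent_drift hC hfy hz i₀ hv hbv
  refine ⟨fun k => ∑ i, ε i k, by simpa using tendsto_finsetSum Finset.univ fun i _ => hε i, ?_⟩
  filter_upwards [eventually_all.2 hagent] with k hk
  refine (Finset.sum_le_sum fun i _ => hk i).trans ?_
  rw [Finset.sum_sub_distrib, ← Finset.mul_sum, Finset.sum_sub_distrib, Finset.sum_sub_distrib,
    ← Finset.sum_mul]
  exact sub_le_sub_right (D.weightedSqDist_average_le k z) _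

end IsSubgradientDynamics

/-! ### Delayed information -/

section DelayedInformation

variable {n m d : ℕ} {B : ℕ → Matrix (Fin n) (Fin m) ℝ}

theorem exists_isLastContact {T : ℕ}
    (hcontact : ∀ k i, ∃ s, k ≤ s ∧ s < k + T ∧ (neighbors (B s) i).Nonempty) {k : ℕ} (hk : T ≤ k)
    (i : Fin n) : ∃ s, IsLastContact B i k s ∧ k < s + T := by
  obtain ⟨t, hkt, htk, ht⟩ := hcontact (k + 1 - T) i
  have hmem : t ∈ {t | t ≤ k ∧ (neighbors (B t) i).Nonempty} := ⟨by omega, ht⟩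
  obtain ⟨s, hs⟩ : ∃ s, IsLastContact B i k s :=
    BddAbove.exists_isGreatest_of_nonempty ⟨k, fun t ht => ht.1⟩ ⟨t, hmem⟩
  have hts : t ≤ s := hs.2 hmem
  exact ⟨s, hs, by omega⟩

variable {xb : ℕ → Fin n → Euc d} {y : ℕ → Fin m → Euc d}

theorem eventually_received_mem (hnonneg : ∀ k i j, 0 ≤ B k i j)
    (hsum : ∀ s i, (neighbors (B s) i).Nonempty → ∑ j ∈ neighbors (B s) i, B s i j = 1)
    {T : ℕ} (hcontact : ∀ k i, ∃ s, k ≤ s ∧ s < k + T ∧ (neighbors (B s) i).Nonempty)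
    (hxb : ∀ k i s, IsLastContact B i k s → xb k i = neighborAverage (B s) (y s) i)
    {K : Set (Euc d)} (hK : Convex ℝ K) (hy : ∀ k i, y (k + 1) i ∈ K) :
    ∀ᶠ k in atTop, ∀ i, xb k i ∈ K := by
  filter_upwards [eventually_ge_atTop (T + 1)] with k hk i
  obtain ⟨s, hs, hks⟩ := exists_isLastContact hcontact (by omega : T ≤ k) i
  rw [hxb k i s hs]
  obtain ⟨s, rfl⟩ := Nat.exists_eq_add_of_le' (by omega : 1 ≤ s)
  exact hK.sum_mem (fun j _ => hnonneg _ _ _) (hsum _ i hs.1.2) fun j _ => hy s j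

theorem tendsto_received_sub (hnonneg : ∀ k i j, 0 ≤ B k i j)
    (hsum : ∀ s i, (neighbors (B s) i).Nonempty → ∑ j ∈ neighbors (B s) i, B s i j = 1)
    {T : ℕ} (hcontact : ∀ k i, ∃ s, k ≤ s ∧ s < k + T ∧ (neighbors (B s) i).Nonempty)
    (hxb : ∀ k i s, IsLastContact B i k s → xb k i = neighborAverage (B s) (y s) i)
    (hy : ∀ d i j, Tendsto (fun k => y (k + d) i - y k j) atTop (𝓝 0))
    (i : Fin n) (j₀ : Fin m) : Tendsto (fun k => xb k i - y k j₀) atTop (𝓝 0) := by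
  rw [Metric.tendsto_atTop]
  intro ε hε
  have hclose : ∀ᶠ s in atTop, ∀ d ∈ Finset.range T, ∀ j, ‖y s j - y (s + d) j₀‖ < ε := by
    refine (Filter.eventually_all_finset _).2 fun d _ => eventually_all.2 fun j => ?_
    filter_upwards [(hy d j₀ j).eventually (Metric.ball_mem_nhds 0 hε)] with s hs
    rwa [norm_sub_rev, ← mem_ball_zero_iff]
  obtain ⟨K, hK⟩ := eventually_atTop.1 hclose
  refine ⟨K + T, fun k hk => ?_⟩
  obtain ⟨s, hs, hks⟩ := exists_isLastContact hcontact (by omega : T ≤ k) i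
  obtain ⟨d, rfl⟩ := Nat.exists_eq_add_of_le hs.1.1
  rw [dist_zero_right, ← mem_ball_iff_norm, hxb _ i s hs]
  exact (convex_ball _ _).sum_mem (fun j _ => hnonneg s i j) (hsum s i hs.1.2) fun j _ =>
    mem_ball_iff_norm.2 (hK s (by omega) d (Finset.mem_range.2 (by omega)) j)

end DelayedInformation

/-! ### Convergence of the Lyapunov function -/

section Lyapunov

variable {V γ : ℕ → ℝ}

theorem exists_ge_lt_of_drift (hV : ∀ k, 0 ≤ V k)
    (hγsum : Tendsto (fun k => ∑ s ∈ Finset.range k, γ s) atTop atTop) {c θ : ℝ} (hc : 0 < c)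
    {K : ℕ} (hdrift : ∀ k ≥ K, θ ≤ V k → V (k + 1) ≤ V k - c * γ k) : ∃ k ≥ K, V k < θ := by
  by_contra! hge
  have hdecrease : ∀ k ≥ K,
      V k ≤ V K - c * (∑ s ∈ Finset.range k, γ s - ∑ s ∈ Finset.range K, γ s) := by
    intro k hk
    induction k, hk using Nat.le_induction with
    | base => simp
    | succ k hk ih =>
      rw [Finset.sum_range_succ]
      linarith [hdrift k hk (hge k hk)]
  obtain ⟨k, hlarge, hk⟩ := ((hγsum.eventually_gt_atTop
    (V K / c + ∑ s ∈ Finset.range K, γ s)).and (eventually_ge_atTop K)).exists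
  have hVK : V K < (∑ s ∈ Finset.range k, γ s - ∑ s ∈ Finset.range K, γ s) * c :=
    (div_lt_iff₀ hc).1 (by linarith)
  linarith [hdecrease k hk, hV k]

theorem tendsto_zero_of_drift (hV : ∀ k, 0 ≤ V k) (hγ : ∀ k, 0 ≤ γ k)
    (hγsum : Tendsto (fun k => ∑ s ∈ Finset.range k, γ s) atTop atTop)
    (hdrift : ∀ θ > 0, ∃ c > 0, ∀ᶠ k in atTop, θ ≤ V k → V (k + 1) ≤ V k - c * γ k)
    (hjump : ∀ θ > 0, ∀ᶠ k in atTop, V k < θ → V (k + 1) < 2 * θ) : Tendsto V atTop (𝓝 0) := by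
  rw [Metric.tendsto_atTop]
  intro ε hε
  obtain ⟨c, hc, hdrift⟩ := hdrift (ε / 2) (half_pos hε)
  obtain ⟨K, hK⟩ := eventually_atTop.1 (hdrift.and (hjump (ε / 2) (half_pos hε)))
  obtain ⟨k₀, hk₀, hVk₀⟩ := exists_ge_lt_of_drift hV hγsum hc fun k hk => (hK k hk).1
  refine ⟨k₀, fun k hk => ?_⟩
  rw [dist_zero_right, Real.norm_of_nonneg (hV k)]
  induction k, hk using Nat.le_induction with
  | base => linarith
  | succ k hk ih =>
    obtain ⟨hdrift, hjump⟩ := hK k (hk₀.trans hk)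
    rcases lt_or_ge (V k) (ε / 2) with hlt | hge
    · linarith [hjump hlt]
    · linarith [hdrift hge, mul_nonneg hc.le (hγ k)]

variable {ρ ε τ G : ℕ → ℝ}

theorem drift_of_perturbed_descent (hγ : ∀ k, 0 ≤ γ k) (hε : Tendsto ε atTop (𝓝 0))
    (hτ : Tendsto τ atTop (𝓝 0)) (hρτ : ∀ k, 0 ≤ ρ k + τ k) (hupper : ∀ k, V k ≤ (ρ k + τ k) ^ 2)
    (hdescent : ∀ᶠ k in atTop, V (k + 1) ≤ V k - 2 * γ k * (G k - ε k * (1 + ρ k)))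
    (hgrowth : ∀ δ > 0, ∃ d > 0, ∀ᶠ k in atTop, δ ≤ ρ k → d * ρ k ≤ G k) {θ : ℝ} (hθ : 0 < θ) :
    ∃ c > 0, ∀ᶠ k in atTop, θ ≤ V k → V (k + 1) ≤ V k - c * γ k := by
  set δ := √θ / 2
  have hδ : 0 < δ := by positivity
  obtain ⟨d, hd, hgrowth⟩ := hgrowth δ hδ
  have hε' : Tendsto (fun k => |ε k| * (1 / δ + 1)) atTop (𝓝 0) := by
    simpa using hε.abs.mul_const (1 / δ + 1)
  refine ⟨d * δ, mul_pos hd hδ, ?_⟩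
  filter_upwards [hdescent, hgrowth, hτ.eventually_le_const hδ,
    hε'.eventually_le_const (half_pos hd)] with k hdescent hgrowth hτk hεk hVk
  have hδρ : δ ≤ ρ k := by
    have hsqrt : √θ ≤ ρ k + τ k := Real.sqrt_le_iff.2 ⟨hρτ k, hVk.trans (hupper k)⟩
    linarith [show δ + δ = √θ from add_halves √θ]
  have hρ : 0 ≤ ρ k := hδ.le.trans hδρ
  have herror : ε k * (1 + ρ k) ≤ d / 2 * ρ k := by
    have hone : 1 ≤ 1 / δ * ρ k := by rwa [one_div_mul_eq_div, one_le_div hδ]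
    calc ε k * (1 + ρ k) ≤ |ε k| * (1 / δ * ρ k + ρ k) := by
          gcongr
          exact le_abs_self _
      _ = |ε k| * (1 / δ + 1) * ρ k := by ring
      _ ≤ d / 2 * ρ k := by gcongr
  have hgain : d * δ / 2 ≤ G k - ε k * (1 + ρ k) := by
    linarith [hgrowth hδρ, mul_le_mul_of_nonneg_left hδρ hd.le]
  linarith [mul_le_mul_of_nonneg_left hgain (mul_nonneg zero_le_two (hγ k))]

theorem jump_of_perturbed_descent (hγ : ∀ k, 0 ≤ γ k) (hγlim : Tendsto γ atTop (𝓝 0))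
    (hε : Tendsto ε atTop (𝓝 0)) (hρ : ∀ k, 0 ≤ ρ k) {c : ℝ} (hc : 0 < c)
    (hlower : ∀ k, c * ρ k ^ 2 ≤ V k) (hG : ∀ᶠ k in atTop, 0 ≤ G k)
    (hdescent : ∀ᶠ k in atTop, V (k + 1) ≤ V k - 2 * γ k * (G k - ε k * (1 + ρ k)))
    {θ : ℝ} (hθ : 0 < θ) : ∀ᶠ k in atTop, V k < θ → V (k + 1) < 2 * θ := by
  set R := √(θ / c)
  have hlim : Tendsto (fun k => 2 * γ k * (|ε k| * (1 + R))) atTop (𝓝 0) := by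
    simpa using (hγlim.const_mul 2).mul (hε.abs.mul_const (1 + R))
  filter_upwards [hdescent, hG, hlim.eventually_lt_const hθ] with k hdescent hG hsmall hVk
  have hρR : ρ k ≤ R := Real.le_sqrt_of_sq_le (by
    rw [le_div_iff₀' hc]
    exact (hlower k).trans hVk.le)
  have herror : ε k * (1 + ρ k) ≤ |ε k| * (1 + R) :=
    mul_le_mul (le_abs_self _) (by linarith) (by linarith [hρ k]) (abs_nonneg _)
  have hstep : -(|ε k| * (1 + R)) ≤ G k - ε k * (1 + ρ k) := by linarith
  linarith [mul_le_mul_of_nonneg_left hstep (mul_nonneg zero_le_two (hγ k))]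

theorem tendsto_zero_of_perturbed_descent (hγ : ∀ k, 0 ≤ γ k) (hγlim : Tendsto γ atTop (𝓝 0))
    (hγsum : Tendsto (fun k => ∑ s ∈ Finset.range k, γ s) atTop atTop)
    (hε : Tendsto ε atTop (𝓝 0)) (hρ : ∀ k, 0 ≤ ρ k)
    (hτ : Tendsto τ atTop (𝓝 0)) (hτ0 : ∀ k, 0 ≤ τ k) {c : ℝ} (hc : 0 < c)
    (hlower : ∀ k, c * ρ k ^ 2 ≤ V k) (hupper : ∀ k, V k ≤ (ρ k + τ k) ^ 2)
    (hG : ∀ᶠ k in atTop, 0 ≤ G k)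
    (hdescent : ∀ᶠ k in atTop, V (k + 1) ≤ V k - 2 * γ k * (G k - ε k * (1 + ρ k)))
    (hgrowth : ∀ δ > 0, ∃ d > 0, ∀ᶠ k in atTop, δ ≤ ρ k → d * ρ k ≤ G k) :
    Tendsto V atTop (𝓝 0) :=
  tendsto_zero_of_drift (fun k => (mul_nonneg hc.le (sq_nonneg _)).trans (hlower k)) hγ hγsum
    (fun _ => drift_of_perturbed_descent hγ hε hτ (fun k => add_nonneg (hρ k) (hτ0 k)) hupper
      hdescent hgrowth)
    fun _ => jump_of_perturbed_descent hγ hγlim hε hρ hc hlower hG hdescent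

theorem exists_linear_growth_add {α : Type*} {l : Filter α} {a b G₁ G₂ : α → ℝ}
    (hG₁ : ∀ᶠ k in l, 0 ≤ G₁ k) (hG₂ : ∀ᶠ k in l, 0 ≤ G₂ k)
    (h₁ : ∀ δ > 0, ∃ d > 0, ∀ᶠ k in l, δ ≤ a k → d * a k ≤ G₁ k)
    (h₂ : ∀ δ > 0, ∃ d > 0, ∀ᶠ k in l, δ ≤ b k → d * b k ≤ G₂ k) {δ : ℝ} (hδ : 0 < δ) :
    ∃ d > 0, ∀ᶠ k in l, δ ≤ a k + b k → d * (a k + b k) ≤ G₁ k + G₂ k := by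
  obtain ⟨d₁, hd₁, h₁⟩ := h₁ (δ / 2) (half_pos hδ)
  obtain ⟨d₂, hd₂, h₂⟩ := h₂ (δ / 2) (half_pos hδ)
  refine ⟨min d₁ d₂ / 2, half_pos (lt_min hd₁ hd₂), ?_⟩
  filter_upwards [hG₁, hG₂, h₁, h₂] with k hG₁ hG₂ h₁ h₂ hδk
  rcases le_total (b k) (a k) with hba | hab
  · have hmin : min d₁ d₂ * ((a k + b k) / 2) ≤ d₁ * a k :=
      mul_le_mul (min_le_left _ _) (by linarith) (by linarith) hd₁.le
    linarith [h₁ (by linarith)]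
  · have hmin : min d₁ d₂ * ((a k + b k) / 2) ≤ d₂ * b k :=
      mul_le_mul (min_le_right _ _) (by linarith) (by linarith) hd₂.le
    linarith [h₂ (by linarith)]

theorem min_div_two_mul_add_sq_le {c₁ c₂ a b v w : ℝ} (hc₁ : 0 ≤ c₁) (hc₂ : 0 ≤ c₂)
    (hv : c₁ * a ^ 2 ≤ v) (hw : c₂ * b ^ 2 ≤ w) : min c₁ c₂ / 2 * (a + b) ^ 2 ≤ v + w :=
  calc min c₁ c₂ / 2 * (a + b) ^ 2 ≤ min c₁ c₂ / 2 * (2 * (a ^ 2 + b ^ 2)) :=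
        mul_le_mul_of_nonneg_left add_sq_le (div_nonneg (le_min hc₁ hc₂) zero_le_two)
    _ = min c₁ c₂ * a ^ 2 + min c₁ c₂ * b ^ 2 := by ring
    _ ≤ c₁ * a ^ 2 + c₂ * b ^ 2 := by
        gcongr
        exacts [min_le_left _ _, min_le_right _ _]
    _ ≤ v + w := add_le_add hv hw

end Lyapunov

/-! ### Convergence to the saddle point -/

namespace IsSubgradientDynamics

section OneSubnetwork

variable {n m₁ m₂ : ℕ} {X : Set (Euc m₁)} {Y : Set (Euc m₂)}
  {f : Fin n → Euc m₁ → Euc m₂ → ℝ} {A : ℕ → Matrix (Fin n) (Fin n) ℝ}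
  {φ est : ℕ → Fin n → ℝ} {γ : ℕ → ℝ} {L : ℝ} {x : ℕ → Fin n → Euc m₁}
  {xb : ℕ → Fin n → Euc m₂} {q : ℕ → Fin n → Euc m₁}

theorem eventually_mem_X (D : IsSubgradientDynamics X Y f A φ est γ L x xb q) (i : Fin n) :
    ∀ᶠ k in atTop, x k i ∈ X :=
  (eventually_ge_atTop 1).mono fun _ hk => D.mem_X hk i

theorem tendsto_spread (D : IsSubgradientDynamics X Y f A φ est γ L x xb q) (i₀ : Fin n) :
    Tendsto (fun k => ∑ i, ‖x k i - x k i₀‖) atTop (𝓝 0) := by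
  simpa using tendsto_finsetSum Finset.univ fun i _ => (D.tendsto_sub i i₀).norm

theorem abs_sumObjective_sub_le (D : IsSubgradientDynamics X Y f A φ est γ L x xb q) {y : Euc m₂}
    (hy : y ∈ Y) {u u' : Euc m₁} (hu : u ∈ X) (hu' : u' ∈ X) :
    |sumObjective f u y - sumObjective f u' y| ≤ n * L * ‖u - u'‖ := by
  calc |sumObjective f u y - sumObjective f u' y| ≤ ∑ i, |f i u y - f i u' y| := by
        rw [sumObjective, sumObjective, ← Finset.sum_sub_distrib]
        exact Finset.abs_sum_le_sum_abs _ _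
    _ ≤ ∑ _i : Fin n, L * ‖u - u'‖ := Finset.sum_le_sum fun i _ => D.abs_sub_le i hy hu hu'
    _ = n * L * ‖u - u'‖ := by simp [mul_assoc]

theorem continuous_sumObjective (D : IsSubgradientDynamics X Y f A φ est γ L x xb q)
    (y : Euc m₂) : Continuous fun u => sumObjective f u y :=
  continuous_finsetSum _ fun i _ => (D.convex_f i y).locallyLipschitz.continuous

theorem exists_linear_growth (D : IsSubgradientDynamics X Y f A φ est γ L x xb q)
    (hX : IsClosed X) {xs : Euc m₁} {ys : Euc m₂}
    (hU : StrictConvexOn ℝ X fun u => sumObjective f u ys) (hxs : xs ∈ X)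
    (hmin : IsMinOn (fun u => sumObjective f u ys) X xs) (i₀ : Fin n) {δ : ℝ} (hδ : 0 < δ) :
    ∃ d > 0, ∀ᶠ k in atTop, δ ≤ ‖x k i₀ - xs‖ →
      d * ‖x k i₀ - xs‖ ≤ sumObjective f (x k i₀) ys - sumObjective f xs ys := by
  obtain ⟨d, hd, hgrowth⟩ := exists_linear_growth_of_strictConvexOn hX
    (D.continuous_sumObjective ys).continuousOn hU hxs hmin hδ
  exact ⟨d, hd, (D.eventually_mem_X i₀).mono fun k hk => hgrowth _ hk⟩

theorem tendsto_of_tendsto_weightedSqDist (D : IsSubgradientDynamics X Y f A φ est γ L x xb q)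
    {z : Euc m₁} (hlim : Tendsto (fun k => weightedSqDist (φ k) (x k) z) atTop (𝓝 0)) (i : Fin n) :
    Tendsto (fun k => x k i) atTop (𝓝 z) := by
  obtain ⟨c, hc, hφ⟩ := D.weights.exists_perron_lower
  refine tendsto_iff_norm_sub_tendsto_zero.2 (squeeze_zero (fun _ => norm_nonneg _)
    (fun k => ?_) (g := fun k => √(weightedSqDist (φ k) (x k) z / c)) ?_)
  · refine Real.le_sqrt_of_sq_le ?_
    rw [le_div_iff₀' hc]
    exact mul_sq_le_weightedSqDist hc.le (hφ k _ (D.perron k)) (x k) z i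
  · simpa using (hlim.div_const c).sqrt

end OneSubnetwork

variable {n₁ n₂ m₁ m₂ : ℕ} {X : Set (Euc m₁)} {Y : Set (Euc m₂)}
  {f : Fin n₁ → Euc m₁ → Euc m₂ → ℝ} {h : Fin n₂ → Euc m₂ → Euc m₁ → ℝ}
  {A₁ : ℕ → Matrix (Fin n₁) (Fin n₁) ℝ} {A₂ : ℕ → Matrix (Fin n₂) (Fin n₂) ℝ}
  {φ₁ est₁ : ℕ → Fin n₁ → ℝ} {φ₂ est₂ : ℕ → Fin n₂ → ℝ} {γ : ℕ → ℝ} {L₁ L₂ : ℝ}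
  {x q₁ : ℕ → Fin n₁ → Euc m₁} {y q₂ : ℕ → Fin n₂ → Euc m₂}
  {xb : ℕ → Fin n₁ → Euc m₂} {yb : ℕ → Fin n₂ → Euc m₁} {xs : Euc m₁} {ys : Euc m₂}

/-- The subgradient bounds control `f i` only in `x`. In `y` the sum of the `f i` inherits a bound
from the other subnetwork, and concavity passes it on to each summand. -/
theorem exists_cross_lipschitz (D₁ : IsSubgradientDynamics X Y f A₁ φ₁ est₁ γ L₁ x xb q₁)
    (D₂ : IsSubgradientDynamics Y X h A₂ φ₂ est₂ γ L₂ y yb q₂)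
    (hf : ∀ i x, ConcaveOn ℝ Set.univ (f i x))
    (hzero : ∀ x ∈ X, ∀ y ∈ Y, sumObjective f x y = -sumObjective h y x)
    (hX : X.Nonempty) (hY : Y.Nonempty) :
    ∃ C, 0 ≤ C ∧ ∀ i, ∀ x ∈ X, ∀ y ∈ Y, ∀ y' ∈ Y,
      |f i x y - f i x y'| ≤ C * (1 + ‖x‖ + ‖y‖ + ‖y'‖) * ‖y - y'‖ := by
  refine exists_lipschitz_linear_growth hX hY D₂.convex_X hf D₁.L_nonneg
    (mul_nonneg n₂.cast_nonneg D₂.L_nonneg) (fun i x hx x' hx' y hy => D₁.abs_sub_le i hy hx hx')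
    fun x hx y hy y' hy' => ?_
  change |sumObjective f x y - sumObjective f x y'| ≤ _
  rw [hzero x hx y hy, hzero x hx y' hy', neg_sub_neg, abs_sub_comm]
  exact D₂.abs_sumObjective_sub_le hx hy hy'

theorem exists_joint_drift (D₁ : IsSubgradientDynamics X Y f A₁ φ₁ est₁ γ L₁ x xb q₁)
    (D₂ : IsSubgradientDynamics Y X h A₂ φ₂ est₂ γ L₂ y yb q₂)
    (hf : ∀ i x, ConcaveOn ℝ Set.univ (f i x)) (hh : ∀ j y, ConcaveOn ℝ Set.univ (h j y))
    (hzero : ∀ x ∈ X, ∀ y ∈ Y, sumObjective f x y = -sumObjective h y x)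
    (hxb : ∀ i j, Tendsto (fun k => xb k i - y k j) atTop (𝓝 0))
    (hyb : ∀ j i, Tendsto (fun k => yb k j - x k i) atTop (𝓝 0))
    (hxs : xs ∈ X) (hys : ys ∈ Y) (i₀ : Fin n₁) (j₀ : Fin n₂) :
    ∃ ε : ℕ → ℝ, Tendsto ε atTop (𝓝 0) ∧ ∀ᶠ k in atTop,
      weightedSqDist (φ₁ (k + 1)) (x (k + 1)) xs + weightedSqDist (φ₂ (k + 1)) (y (k + 1)) ys ≤
        weightedSqDist (φ₁ k) (x k) xs + weightedSqDist (φ₂ k) (y k) ys -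
          2 * γ k * (sumObjective f (x k i₀) ys - sumObjective f xs ys +
            (sumObjective h (y k j₀) xs - sumObjective h ys xs) -
              ε k * (1 + (‖x k i₀ - xs‖ + ‖y k j₀ - ys‖))) := by
  have hzero' : ∀ y ∈ Y, ∀ x ∈ X, sumObjective h y x = -sumObjective f x y := fun y hy x hx => by
    rw [hzero x hx y hy, neg_neg]
  obtain ⟨C₁, hC₁, hfy⟩ := D₁.exists_cross_lipschitz D₂ hf hzero ⟨xs, hxs⟩ ⟨ys, hys⟩
  obtain ⟨C₂, hC₂, hhx⟩ := D₂.exists_cross_lipschitz D₁ hh hzero' ⟨ys, hys⟩ ⟨xs, hxs⟩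
  obtain ⟨ε₁, hε₁, hdrift₁⟩ := D₁.exists_drift hC₁ hfy hxs i₀ (D₂.eventually_mem_X j₀)
    fun i => hxb i j₀
  obtain ⟨ε₂, hε₂, hdrift₂⟩ := D₂.exists_drift hC₂ hhx hys j₀ (D₁.eventually_mem_X i₀)
    fun j => hyb j i₀
  refine ⟨fun k => (|ε₁ k| + |ε₂ k|) * (1 + ‖xs‖ + ‖ys‖), by
    simpa using (hε₁.abs.add hε₂.abs).mul_const (1 + ‖xs‖ + ‖ys‖), ?_⟩
  filter_upwards [hdrift₁, hdrift₂, D₁.eventually_mem_X i₀, D₂.eventually_mem_X j₀] with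
    k hdrift₁ hdrift₂ hx hy
  have hnorm : 1 + ‖x k i₀‖ + ‖y k j₀‖ ≤
      (1 + ‖xs‖ + ‖ys‖) * (1 + (‖x k i₀ - xs‖ + ‖y k j₀ - ys‖)) := by
    have hcross : 0 ≤ (‖xs‖ + ‖ys‖) * (‖x k i₀ - xs‖ + ‖y k j₀ - ys‖) := by positivity
    linarith [norm_sub_norm_le (x k i₀) xs, norm_sub_norm_le (y k j₀) ys]
  have herror : (ε₁ k + ε₂ k) * (1 + ‖x k i₀‖ + ‖y k j₀‖) ≤ (|ε₁ k| + |ε₂ k|) *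
      (1 + ‖xs‖ + ‖ys‖) * (1 + (‖x k i₀ - xs‖ + ‖y k j₀ - ys‖)) := by
    rw [mul_assoc]
    gcongr
    exacts [le_abs_self _, le_abs_self _]
  have hscaled := mul_le_mul_of_nonneg_left herror (mul_nonneg zero_le_two (D₁.step_nonneg k))
  rw [hzero' _ hy _ hx, hzero' _ hys _ hx] at hdrift₂
  rw [hzero' _ hy _ hxs, hzero' _ hys _ hxs]
  linarith

theorem tendsto_lyapunov (D₁ : IsSubgradientDynamics X Y f A₁ φ₁ est₁ γ L₁ x xb q₁)
    (D₂ : IsSubgradientDynamics Y X h A₂ φ₂ est₂ γ L₂ y yb q₂)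
    (hf : ∀ i x, ConcaveOn ℝ Set.univ (f i x)) (hh : ∀ j y, ConcaveOn ℝ Set.univ (h j y))
    (hzero : ∀ x ∈ X, ∀ y ∈ Y, sumObjective f x y = -sumObjective h y x)
    (hγsum : Tendsto (fun k => ∑ s ∈ Finset.range k, γ s) atTop atTop)
    (hX : IsClosed X) (hY : IsClosed Y) (hxs : xs ∈ X) (hys : ys ∈ Y)
    (hUx : StrictConvexOn ℝ X fun u => sumObjective f u ys)
    (hUy : StrictConvexOn ℝ Y fun v => sumObjective h v xs)
    (hminx : IsMinOn (fun u => sumObjective f u ys) X xs)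
    (hminy : IsMinOn (fun v => sumObjective h v xs) Y ys)
    (hxb : ∀ i j, Tendsto (fun k => xb k i - y k j) atTop (𝓝 0))
    (hyb : ∀ j i, Tendsto (fun k => yb k j - x k i) atTop (𝓝 0)) (i₀ : Fin n₁) (j₀ : Fin n₂) :
    Tendsto (fun k => weightedSqDist (φ₁ k) (x k) xs + weightedSqDist (φ₂ k) (y k) ys)
      atTop (𝓝 0) := by
  have : Nonempty (Fin n₁) := ⟨i₀⟩
  have : Nonempty (Fin n₂) := ⟨j₀⟩
  obtain ⟨c₁, hc₁, hφ₁⟩ := D₁.weights.exists_perron_lower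
  obtain ⟨c₂, hc₂, hφ₂⟩ := D₂.weights.exists_perron_lower
  obtain ⟨ε, hε, hdescent⟩ := D₁.exists_joint_drift D₂ hf hh hzero hxb hyb hxs hys i₀ j₀
  have hgain₁ : ∀ᶠ k in atTop, 0 ≤ sumObjective f (x k i₀) ys - sumObjective f xs ys :=
    (D₁.eventually_mem_X i₀).mono fun k hk => sub_nonneg.2 (hminx hk)
  have hgain₂ : ∀ᶠ k in atTop, 0 ≤ sumObjective h (y k j₀) xs - sumObjective h ys xs :=
    (D₂.eventually_mem_X j₀).mono fun k hk => sub_nonneg.2 (hminy hk)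
  refine tendsto_zero_of_perturbed_descent D₁.step_nonneg D₁.step_lim hγsum hε
    (ρ := fun k => ‖x k i₀ - xs‖ + ‖y k j₀ - ys‖) (fun k => by positivity)
    (by simpa using (D₁.tendsto_spread i₀).add (D₂.tendsto_spread j₀)) (fun k => by positivity)
    (half_pos (lt_min hc₁ hc₂))
    (fun k => min_div_two_mul_add_sq_le hc₁.le hc₂.le
      (mul_sq_le_weightedSqDist hc₁.le (hφ₁ k _ (D₁.perron k)) (x k) xs i₀)
      (mul_sq_le_weightedSqDist hc₂.le (hφ₂ k _ (D₂.perron k)) (y k) ys j₀))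
    (fun k => ?_) (hgain₁.and hgain₂ |>.mono fun k hk => add_nonneg hk.1 hk.2) hdescent
    fun δ => exists_linear_growth_add hgain₁ hgain₂
      (fun δ => D₁.exists_linear_growth hX hUx hxs hminx i₀)
      fun δ => D₂.exists_linear_growth hY hUy hys hminy j₀
  rw [add_add_add_comm]
  exact (add_le_add (weightedSqDist_le_sq (D₁.perron_mem_stdSimplex k) (x k) xs i₀)
    (weightedSqDist_le_sq (D₂.perron_mem_stdSimplex k) (y k) ys j₀)).trans
    (pow_add_pow_le (by positivity) (by positivity) two_ne_zero)

theorem tendsto_saddlePoint (D₁ : IsSubgradientDynamics X Y f A₁ φ₁ est₁ γ L₁ x xb q₁)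
    (D₂ : IsSubgradientDynamics Y X h A₂ φ₂ est₂ γ L₂ y yb q₂)
    (hf : ∀ i x, ConcaveOn ℝ Set.univ (f i x)) (hh : ∀ j y, ConcaveOn ℝ Set.univ (h j y))
    (hzero : ∀ x ∈ X, ∀ y ∈ Y, sumObjective f x y = -sumObjective h y x)
    (hγsum : Tendsto (fun k => ∑ s ∈ Finset.range k, γ s) atTop atTop)
    (hX : IsClosed X) (hY : IsClosed Y) (hxs : xs ∈ X) (hys : ys ∈ Y)
    (hUx : StrictConvexOn ℝ X fun u => sumObjective f u ys)
    (hUy : StrictConvexOn ℝ Y fun v => sumObjective h v xs)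
    (hminx : IsMinOn (fun u => sumObjective f u ys) X xs)
    (hminy : IsMinOn (fun v => sumObjective h v xs) Y ys)
    (hxb : ∀ i j, Tendsto (fun k => xb k i - y k j) atTop (𝓝 0))
    (hyb : ∀ j i, Tendsto (fun k => yb k j - x k i) atTop (𝓝 0)) (i : Fin n₁) (j : Fin n₂) :
    Tendsto (fun k => x k i) atTop (𝓝 xs) ∧ Tendsto (fun k => y k j) atTop (𝓝 ys) := by
  have : Nonempty (Fin n₁) := ⟨i⟩
  have : Nonempty (Fin n₂) := ⟨j⟩
  have hlim := D₁.tendsto_lyapunov D₂ hf hh hzero hγsum hX hY hxs hys hUx hUy hminx hminy hxb hyb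
    i j
  have hx0 := fun k => weightedSqDist_nonneg (D₁.perron_mem_stdSimplex k).1 (x k) xs
  have hy0 := fun k => weightedSqDist_nonneg (D₂.perron_mem_stdSimplex k).1 (y k) ys
  exact ⟨D₁.tendsto_of_tendsto_weightedSqDist
      (squeeze_zero hx0 (fun k => le_add_of_nonneg_right (hy0 k)) hlim) i,
    D₂.tendsto_of_tendsto_weightedSqDist
      (squeeze_zero hy0 (fun k => le_add_of_nonneg_left (hx0 k)) hlim) j⟩

end IsSubgradientDynamics

/-! ### Runs of the algorithm -/

theorem StepsizeCondition.tendsto_zero {γ : ℕ → ℝ} (hγ : StepsizeCondition γ) :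
    Tendsto γ atTop (𝓝 0) := by
  have hsq : Tendsto (fun k => γ k ^ 2) atTop (𝓝 0) := hγ.2.2.2.tendsto_atTop_zero
  simpa [tendsto_zero_iff_abs_tendsto_zero, Real.sqrt_sq_eq_abs, Function.comp_def] using hsq.sqrt

theorem StepsizeCondition.nonneg {γ : ℕ → ℝ} (hγ : StepsizeCondition γ) (k : ℕ) : 0 ≤ γ k :=
  hγ.2.1.le_of_tendsto hγ.tendsto_zero k

theorem SaddlePointsExist.exists_isSaddlePoint_sumObjective {n m₁ m₂ : ℕ} (hn : 0 < n)
    {X : Set (Euc m₁)} {Y : Set (Euc m₂)} {f : Fin n → Euc m₁ → Euc m₂ → ℝ}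
    (h : SaddlePointsExist X Y f) : ∃ xs ys, IsSaddlePoint X Y (sumObjective f) xs ys := by
  have hn_pos : (0 : ℝ) < (n : ℝ)⁻¹ := inv_pos.2 (Nat.cast_pos.2 hn)
  have huniform : (fun _ => (n : ℝ)⁻¹) ∈ stdSimplex ℝ (Fin n) :=
    ⟨fun _ => hn_pos.le, by simp [hn.ne']⟩
  obtain ⟨xs, ys, hxs, hys, hmax, hmin⟩ := h _ huniform
  simp only [← Finset.mul_sum] at hmax hmin
  exact ⟨xs, ys, hxs, hys, fun y hy => le_of_mul_le_mul_left (hmax y hy) hn_pos,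
    fun x hx => le_of_mul_le_mul_left (hmin x hx) hn_pos⟩

theorem neg_mem_convexSubdiff_neg {m : ℕ} {φ : Euc m → ℝ} {z q : Euc m} :
    -q ∈ convexSubdiff (fun w => -φ w) z ↔ q ∈ concaveSubdiff φ z :=
  forall_congr' fun w => by rw [inner_neg_right, ← neg_add, neg_le_neg_iff]

theorem consensusWeights_of_sum_neighbors_eq_one {n : ℕ} {A : ℕ → Matrix (Fin n) (Fin n) ℝ}
    (hnonneg : ∀ k i j, 0 ≤ A k i j) (hloop : ∀ k i, 0 < A k i i) {η : ℝ} (hη : 0 < η)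
    (hlower : WeightsAtLeast η A) (hsum : ∀ k i, ∑ j ∈ neighbors (A k) i, A k i j = 1)
    (hconn : UJSC A) : ConsensusWeights A where
  stochastic k := by
    refine Matrix.mem_rowStochastic_iff_sum.2 ⟨hnonneg k, fun i => ?_⟩
    simpa [hsum k i] using (sum_neighbors_smul (hnonneg k) (fun _ => (1 : ℝ)) i).symm
  loop_pos := hloop
  exists_lower := ⟨η, hη, fun k i j hij => hlower k i j (by simpa [neighbors] using hij)⟩
  ujsc := hconn

theorem WeightRule.consensusWeights {n₁ n₂ : ℕ} {N : Network n₁ n₂} (hN : WeightRule N)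
    (hconn : Connectivity N) : ConsensusWeights N.A₁ ∧ ConsensusWeights N.A₂ := by
  obtain ⟨⟨η, hη, -, hlower₁, hlower₂, -, -⟩, hsum₁, hsum₂, -, -⟩ := hN
  exact ⟨consensusWeights_of_sum_neighbors_eq_one N.A₁_nonneg N.A₁_loop hη hlower₁ hsum₁ hconn.2.1,
    consensusWeights_of_sum_neighbors_eq_one N.A₂_nonneg N.A₂_loop hη hlower₂ hsum₂ hconn.2.2⟩

theorem LearnsPerron.exists_isSubgradientDynamics {n m₁ m₂ : ℕ} {X : Set (Euc m₁)}
    {Y : Set (Euc m₂)} {f : Fin n → Euc m₁ → Euc m₂ → ℝ} {A : ℕ → Matrix (Fin n) (Fin n) ℝ}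
    {est : Estimator n} {γ : ℕ → ℝ} {L : ℝ} {x q : ℕ → Fin n → Euc m₁} {xb : ℕ → Fin n → Euc m₂}
    (hest : LearnsPerron A est) (hA : ConsensusWeights A) (hX : Convex ℝ X)
    (hf : ∀ i y, ConvexOn ℝ Set.univ fun x => f i x y) (hγ : ∀ k, 0 ≤ γ k)
    (hγlim : Tendsto γ atTop (𝓝 0)) (hL : 0 ≤ L)
    (hbound : ∀ i, ∀ x ∈ X, ∀ y ∈ Y, ∀ q ∈ convexSubdiff (fun x' => f i x' y) x, ‖q‖ ≤ L)
    (hxb : ∀ᶠ k in atTop, ∀ i, xb k i ∈ Y)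
    (hq : ∀ k i, q k i ∈ convexSubdiff (fun x' => f i x' (xb k i)) (neighborAverage (A k) (x k) i))
    (hproj : ∀ k i, IsProjection X
      (neighborAverage (A k) (x k) i - learnedStepsize A est γ k i • q k i) (x (k + 1) i)) :
    ∃ φ, IsSubgradientDynamics X Y f A φ (est A) γ L x xb q := by
  obtain ⟨hpos, φ, hφ, hlim⟩ := hest
  have haverage : ∀ k i, neighborAverage (A k) (x k) i = ∑ j, A k i j • x k j := fun k i =>
    sum_neighbors_smul (hA.nonneg k) (x k) i
  simp only [haverage, learnedStepsize] at hq hproj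
  exact ⟨φ, hA, hX, hf, hφ, hpos, hlim, hγ, hγlim, hL, hbound, hxb, hq, hproj⟩

section Nash

variable {n₁ n₂ m₁ m₂ : ℕ} {X : Set (Euc m₁)} {Y : Set (Euc m₂)}
  {f : Fin n₁ → Euc m₁ → Euc m₂ → ℝ} {g : Fin n₂ → Euc m₁ → Euc m₂ → ℝ} {γ : ℕ → ℝ}

/-- Both subnetworks minimise: the second one has the objectives `-g j`, with the arguments
exchanged. -/
theorem IsSubgradientDynamics.tendsto_isSaddlePoint
    (hX : IsClosed X) (hY : IsClosed Y) (hf : ∀ i, ConvexConcave (f i))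
    (hg : ∀ j, ConvexConcave (g j))
    (hfg : ∀ x ∈ X, ∀ y ∈ Y, sumObjective f x y = sumObjective g x y)
    (hU : StrictConvexConcaveOn X Y (sumObjective f)) {xs : Euc m₁} {ys : Euc m₂}
    (hs : IsSaddlePoint X Y (sumObjective f) xs ys)
    (hγsum : Tendsto (fun k => ∑ s ∈ Finset.range k, γ s) atTop atTop)
    {A₁ : ℕ → Matrix (Fin n₁) (Fin n₁) ℝ} {A₂ : ℕ → Matrix (Fin n₂) (Fin n₂) ℝ}
    {φ₁ est₁ : ℕ → Fin n₁ → ℝ} {φ₂ est₂ : ℕ → Fin n₂ → ℝ} {L₁ L₂ : ℝ}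
    {x q₁ : ℕ → Fin n₁ → Euc m₁} {y q₂ : ℕ → Fin n₂ → Euc m₂}
    {xb : ℕ → Fin n₁ → Euc m₂} {yb : ℕ → Fin n₂ → Euc m₁}
    (D₁ : IsSubgradientDynamics X Y f A₁ φ₁ est₁ γ L₁ x xb q₁)
    (D₂ : IsSubgradientDynamics Y X (fun j y x => -g j x y) A₂ φ₂ est₂ γ L₂ y yb q₂)
    (hxb : ∀ i j, Tendsto (fun k => xb k i - y k j) atTop (𝓝 0))
    (hyb : ∀ j i, Tendsto (fun k => yb k j - x k i) atTop (𝓝 0)) (i : Fin n₁) (j : Fin n₂) :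
    Tendsto (fun k => x k i) atTop (𝓝 xs) ∧ Tendsto (fun k => y k j) atTop (𝓝 ys) := by
  obtain ⟨hxs, hys, hmax, hmin⟩ := hs
  have hneg : ∀ x y, sumObjective (fun j y x => -g j x y) y x = -sumObjective g x y :=
    fun x y => Finset.sum_neg_distrib _
  have hsecond : ∀ y ∈ Y, -sumObjective f xs y = sumObjective (fun j y x => -g j x y) y xs :=
    fun y hy => by rw [hneg, hfg xs hxs y hy]
  refine D₁.tendsto_saddlePoint D₂ (fun i => (hf i).2) (fun j y => ((hg j).1 y).neg)
    (fun x hx y hy => by rw [hneg, neg_neg, hfg x hx y hy]) hγsum hX hY hxs hys (hU.1 ys hys)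
    ((hU.2 xs hxs).neg.congr hsecond) hmin (fun y hy => ?_) hxb hyb i j
  simpa only [Set.mem_ofPred_eq, ← hsecond y hy, ← hsecond ys hys, neg_le_neg_iff] using hmax y hy

theorem achievesNash_of_learnsPerron
    (hXclosed : IsClosed X) (hXconvex : Convex ℝ X) (hYclosed : IsClosed Y) (hYconvex : Convex ℝ Y)
    (hf : ∀ i, ConvexConcave (f i)) (hg : ∀ j, ConvexConcave (g j))
    (hfg : ∀ x ∈ X, ∀ y ∈ Y, sumObjective f x y = sumObjective g x y)
    (hU : StrictConvexConcaveOn X Y (sumObjective f)) {N : Network n₁ n₂}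
    (hsaddle : ∃ xs ys, IsSaddlePoint X Y (sumObjective f) xs ys) (hconn : Connectivity N)
    (hweight : WeightRule N) (hbound : SubgradientsBounded X Y f g) (hγ : ∀ k, 0 ≤ γ k)
    (hγlim : Tendsto γ atTop (𝓝 0))
    (hγsum : Tendsto (fun k => ∑ s ∈ Finset.range k, γ s) atTop atTop)
    {est₁ : Estimator n₁} {est₂ : Estimator n₂}
    (hest₁ : LearnsPerron N.A₁ est₁) (hest₂ : LearnsPerron N.A₂ est₂) :
    AchievesNash X Y f g N (learnedStepsize N.A₁ est₁ γ) (learnedStepsize N.A₂ est₂ γ) := by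
  rintro x y ⟨xb, yb, q₁, q₂, hxb, hyb, hq₁, hq₂, hprojx, hprojy⟩
  obtain ⟨hA₁, hA₂⟩ := hweight.consensusWeights hconn
  obtain ⟨L, hL, hLbound⟩ := hbound
  obtain ⟨xs, ys, hs⟩ := hsaddle
  obtain ⟨⟨T, -, hT⟩, -, -⟩ := hconn
  obtain ⟨-, -, -, hB₁, hB₂⟩ := hweight
  have hcontact₁ := fun k => (hT k).1
  have hcontact₂ := fun k => (hT k).2
  obtain ⟨φ₁, D₁⟩ := hest₁.exists_isSubgradientDynamics hA₁ hXconvex (fun i => (hf i).1) hγ hγlim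
    hL.le (fun i x hx y hy => (hLbound x hx y hy).1 i)
    (eventually_received_mem N.B₁_nonneg hB₁ hcontact₁ hxb hYconvex fun k j => (hprojy k j).1)
    hq₁ hprojx
  obtain ⟨φ₂, D₂⟩ := hest₂.exists_isSubgradientDynamics (f := fun j y x => -g j x y)
    (q := fun k j => -q₂ k j) hA₂ hYconvex (fun j x => ((hg j).2 x).neg) hγ hγlim hL.le
    (fun j y hy x hx q hq => norm_neg q ▸ (hLbound x hx y hy).2 j (-q)
      (neg_mem_convexSubdiff_neg.1 (by rwa [neg_neg])))
    (eventually_received_mem N.B₂_nonneg hB₂ hcontact₂ hyb hXconvex fun k i => (hprojx k i).1)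
    (fun k j => neg_mem_convexSubdiff_neg.2 (hq₂ k j))
    (fun k j => by simpa only [smul_neg, sub_neg_eq_add] using hprojy k j)
  have hlim := D₁.tendsto_isSaddlePoint hXclosed hYclosed hf hg hfg hU hs hγsum D₂
    (tendsto_received_sub N.B₁_nonneg hB₁ hcontact₁ hxb D₂.tendsto_add_sub)
    (tendsto_received_sub N.B₂_nonneg hB₂ hcontact₂ hyb D₁.tendsto_add_sub)
  refine ⟨xs, ys, hs, fun i => ?_, fun j => ?_⟩
  · obtain ⟨_, -, -, j, -⟩ := hcontact₁ 0 i
    exact (hlim i j).1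
  · obtain ⟨_, -, -, i, -⟩ := hcontact₂ 0 j
    exact (hlim i j).2

end Nash

end

theorem theorem5_general {n₁ n₂ m₁ m₂ : ℕ} (X : Set (Euc m₁)) (Y : Set (Euc m₂))
    (hXclosed : IsClosed X) (hXconvex : Convex ℝ X)
    (hYclosed : IsClosed Y) (hYconvex : Convex ℝ Y)
    (f : Fin n₁ → Euc m₁ → Euc m₂ → ℝ) (g : Fin n₂ → Euc m₁ → Euc m₂ → ℝ)
    (hf : ∀ i, ConvexConcave (f i)) (hg : ∀ i, ConvexConcave (g i))
    (hfg : ∀ x ∈ X, ∀ y ∈ Y, sumObjective f x y = sumObjective g x y)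
    (hU : StrictConvexConcaveOn X Y (sumObjective f))
    (N : Network n₁ n₂)
    (hsaddle : ∃ xs ys, IsSaddlePoint X Y (sumObjective f) xs ys)
    (hconn : Connectivity N)
    (hweight : WeightRule N)
    (hbound : SubgradientsBounded X Y f g)
    (γ : ℕ → ℝ) (hγ : ∀ k, 0 ≤ γ k) (hγlim : Tendsto γ atTop (𝓝 0))
    (hγsum : Tendsto (fun k => ∑ s ∈ Finset.range k, γ s) atTop atTop) :
    (IsDistributed (consensusEstimator n₁) ∧ IsDistributed (consensusEstimator n₂) ∧
      ∀ p, IsDistributed (periodicEstimator n₁ p) ∧ IsDistributed (periodicEstimator n₂ p)) ∧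
    (HasCommonLeftEigenvector N.A₁ → HasCommonLeftEigenvector N.A₂ →
      LearnsPerron N.A₁ (consensusEstimator n₁) ∧ LearnsPerron N.A₂ (consensusEstimator n₂) ∧
      AchievesNash X Y f g N (learnedStepsize N.A₁ (consensusEstimator n₁) γ)
        (learnedStepsize N.A₂ (consensusEstimator n₂) γ)) ∧
    (∀ p₁ p₂, SwitchesPeriodically N.A₁ p₁ → SwitchesPeriodically N.A₂ p₂ →
      LearnsPerron N.A₁ (periodicEstimator n₁ p₁) ∧ LearnsPerron N.A₂ (periodicEstimator n₂ p₂) ∧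
      AchievesNash X Y f g N (learnedStepsize N.A₁ (periodicEstimator n₁ p₁) γ)
        (learnedStepsize N.A₂ (periodicEstimator n₂ p₂) γ)) ∧
    (∀ (est₁ : Estimator n₁) (est₂ : Estimator n₂),
      LearnsPerron N.A₁ est₁ → LearnsPerron N.A₂ est₂ →
      AchievesNash X Y f g N (learnedStepsize N.A₁ est₁ γ) (learnedStepsize N.A₂ est₂ γ)) := by
  have hnash : ∀ (est₁ : Estimator n₁) (est₂ : Estimator n₂),
      LearnsPerron N.A₁ est₁ → LearnsPerron N.A₂ est₂ →
      AchievesNash X Y f g N (learnedStepsize N.A₁ est₁ γ) (learnedStepsize N.A₂ est₂ γ) :=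
    fun _ _ => achievesNash_of_learnsPerron hXclosed hXconvex hYclosed hYconvex hf hg hfg hU
      hsaddle hconn hweight hbound hγ hγlim hγsum
  obtain ⟨hA₁, hA₂⟩ := hweight.consensusWeights hconn
  refine ⟨⟨isDistributed_consensusEstimator n₁, isDistributed_consensusEstimator n₂, fun p =>
    ⟨isDistributed_periodicEstimator n₁ p, isDistributed_periodicEstimator n₂ p⟩⟩,
    fun h₁ h₂ => ?_, fun p₁ p₂ h₁ h₂ => ?_, hnash⟩
  · have hlearn₁ := learnsPerron_consensusEstimator hA₁ h₁
    have hlearn₂ := learnsPerron_consensusEstimator hA₂ h₂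
    exact ⟨hlearn₁, hlearn₂, hnash _ _ hlearn₁ hlearn₂⟩
  · have hlearn₁ := learnsPerron_periodicEstimator hA₁ h₁
    have hlearn₂ := learnsPerron_periodicEstimator hA₂ h₂
    exact ⟨hlearn₁, hlearn₂, hnash _ _ hlearn₁ hlearn₂⟩

theorem theorem5 {n₁ n₂ m₁ m₂ : ℕ} (hn₁ : 0 < n₁) (hn₂ : 0 < n₂)
    (X : Set (Euc m₁)) (Y : Set (Euc m₂))
    (hXclosed : IsClosed X) (hXconvex : Convex ℝ X)
    (hYclosed : IsClosed Y) (hYconvex : Convex ℝ Y)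
    (f : Fin n₁ → Euc m₁ → Euc m₂ → ℝ) (g : Fin n₂ → Euc m₁ → Euc m₂ → ℝ)
    (hf : ∀ i, ConvexConcave (f i)) (hg : ∀ i, ConvexConcave (g i))
    (hfg : ∀ x ∈ X, ∀ y ∈ Y, sumObjective f x y = sumObjective g x y)
    (hU : StrictConvexConcaveOn X Y (sumObjective f))
    (N : Network n₁ n₂)
    (hA1 : SaddlePointsExist X Y f)
    (hA2 : Connectivity N)
    (hA3 : WeightRule N)
    (hA4 : SubgradientsBounded X Y f g)
    (γ : ℕ → ℝ) (hγ : StepsizeCondition γ) :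
    -- the estimators below are distributed rules
    (IsDistributed (consensusEstimator n₁) ∧ IsDistributed (consensusEstimator n₂) ∧
      ∀ p, IsDistributed (periodicEstimator n₁ p) ∧ IsDistributed (periodicEstimator n₂ p)) ∧
    -- case (i)
    (HasCommonLeftEigenvector N.A₁ → HasCommonLeftEigenvector N.A₂ →
      LearnsPerron N.A₁ (consensusEstimator n₁) ∧ LearnsPerron N.A₂ (consensusEstimator n₂) ∧
      AchievesNash X Y f g N (learnedStepsize N.A₁ (consensusEstimator n₁) γ)
        (learnedStepsize N.A₂ (consensusEstimator n₂) γ)) ∧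
    -- case (ii)
    (∀ p₁ p₂, SwitchesPeriodically N.A₁ p₁ → SwitchesPeriodically N.A₂ p₂ →
      LearnsPerron N.A₁ (periodicEstimator n₁ p₁) ∧ LearnsPerron N.A₂ (periodicEstimator n₂ p₂) ∧
      AchievesNash X Y f g N (learnedStepsize N.A₁ (periodicEstimator n₁ p₁) γ)
        (learnedStepsize N.A₂ (periodicEstimator n₂ p₂) γ)) ∧
    -- in both cases, any other distributed estimators that learn the Perron entries also work
    ((HasCommonLeftEigenvector N.A₁ ∧ HasCommonLeftEigenvector N.A₂) ∨
        (∃ p₁ p₂, SwitchesPeriodically N.A₁ p₁ ∧ SwitchesPeriodically N.A₂ p₂) →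
      ∀ (est₁ : Estimator n₁) (est₂ : Estimator n₂),
        IsDistributed est₁ → IsDistributed est₂ →
        LearnsPerron N.A₁ est₁ → LearnsPerron N.A₂ est₂ →
        AchievesNash X Y f g N (learnedStepsize N.A₁ est₁ γ) (learnedStepsize N.A₂ est₂ γ)) := by
  obtain ⟨hdistributed, hcommon, hperiodic, hany⟩ := theorem5_general X Y hXclosed hXconvex
    hYclosed hYconvex f g hf hg hfg hU N (hA1.exists_isSaddlePoint_sumObjective hn₁) hA2 hA3 hA4 γ
    hγ.nonneg hγ.tendsto_zero hγ.2.2.1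
  exact ⟨hdistributed, hcommon, hperiodic, fun _ est₁ est₂ _ _ => hany est₁ est₂⟩
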